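/- **Setting.** A stochastic shortest path model $M$ consists of a finite state space $\mathcal S$ with an initial state $s_0$, a goal $g\notin\mathcal S$, finite action sets $\mathcal A_s$, and a known transition function $P(\cdot\mid s,a)$ on $\mathcal S\cup\{g\}$. Let $\Gamma=\{(s,a): s\in\mathcal S, a\in\mathcal A_s\}$ and $SA=|\Gamma|$. A deterministic stationary policy is proper if it reaches $g$ in finitely many steps with probability one from every state; assume that a proper policy exists. $T^\pi(s)$ is the expected hitting time of $g$ from $s$ under $\pi$, $J^\pi_c(s)$ its expected total cost for the cost function $c$, $T_f=\min_{\pi}T^\pi(s_0)$ and $D=\max_s\min_\pi T^\pi(s)$ (minima over proper $\pi$). In each of $K\ge1$ episodes the environment picks $c_k:\Gamma\to[0,1]$ as an arbitrary function of everything that happened in episodes $1,\dots,k-1$, the learner acts from $s_0$ until $g$ is reached, and then $c_k$ is revealed. Let $\pi^\star$ be a proper policy minimizing $\sum_k J^{\pi}_{c_k}(s_0)$ for the realized costs, $T_\star=T^{\pi^\star}(s_0)$ (both may be random), and let the regret $R_K$ be the learner's total cost minus $\sum_kJ^{\pi^\star}_{c_k}(s_0)$. **Algorithm with grid bound $B$.**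 For $x\in\mathbb R_{\ge0}^n$ and rates $\eta_i$ let $\psi_\eta(x)=\sum_i\frac1{\eta_i}x_i\ln x_i$, with Bregman divergence $D_{\psi_\eta}$. Let $$\Delta(T)=\Big\{q\in\mathbb R_{\ge0}^\Gamma:\ \sum_{(s,a)}q(s,a)\le T,\ \sum_{a}q(s,a)-\sum_{(s',a')}P(s\mid s',a')q(s',a')=\mathbf 1\{s=s_0\}\ \forall s\Big\}.$$ Let $j_0=\lceil\log_2T_f\rceil-1$, $b(j)=2^{j_0+j}$, $N=\lceil\log_2B\rceil-j_0$. Worker $j\in\{1,\dots,N\}$ uses $T=b(j)$ and the rate $\eta=\min\{\tfrac12,\sqrt{T\ln(SAT)/(DK)}\}$; it plays $q_1^j=\arg\min_{\Delta(T)}\psi_\eta$ and $q^j_{k+1}=\arg\min_{q\in\Delta(T)}\langle q,c_k\rangle+D_{\psi_\eta}(q,q^j_k)$. The meta algorithm uses $\eta_j=1/\sqrt{32DKb(j)}$, $p_1(j)=\eta_j/(N\eta_1)$ for $j\ne1$ and $p_1(1)=1-\sum_{j\neq1}p_1(j)$. In episode $k$ it samples $j_k\sim p_k$, executes the policy $\pi(a\mid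 s)\propto q_k^{j_k}(s,a)$, and, with $\ell_k(j)=\langle q_k^j,c_k\rangle$ and $a_k(j)=4\eta_j\ell_k(j)^2$, sets $p_{k+1}$ to the minimizer over the probability simplex of $\langle p,\ell_k+a_k\rangle+D_{\psi_{(\eta_j)}}(p,p_k)$. **Theorem.** There is a universal constant $C>0$ such that the following holds for every such model, every $K\ge 1$ and every such environment. Assume that one of the following holds: * $B=DK$; or * $B=K$, $T_f\le K$, and almost surely $T_\star\le K$ or $T_\star\ge DK$. Then, without knowledge of $T_\star$, the algorithm with grid bound $B$ finishes all $K$ episodes with probability one, $R_K$ is integrable, and $$\mathbb E[R_K]\ \le\ C\,\bigl(1+\ln(SA\,B)\bigr)\;\mathbb E\bigl[\sqrt{D\,T_\star\,K}\bigr].$$ In particular $\mathbb E[R_K]=\tilde O(\sqrt{DT_\star K})$ when $T_\star$ is deterministic. -/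

import Mathlib

noncomputable section

universe u v

/-- A stochastic shortest path model with state space `S` (goal excluded), available actions
`A s` at state `s`, initial state `init` and known transition function `P`.
The goal state is `none : Option S`. -/
structure SSP (S : Type u) (A : S → Type v) [Fintype S] [∀ s, Fintype (A s)] where
  init : S
  P : (s : S) → A s → Option S → ℝ
  P_nonneg : ∀ s a x, 0 ≤ P s a x
  P_sum : ∀ s a, ∑ x, P s a x = 1

namespace SSP

/-- A minimizer of `f` over `s` (in every use below it exists and is unique). -/
def argminOn {ι : Type*} (s : Set (ι → ℝ)) (f : (ι → ℝ) → ℝ) : ι → ℝ :=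
  Classical.epsilon fun x => x ∈ s ∧ IsMinOn f s x

/-- The entropic regularizer `ψ(x) = ∑ i, (1 / η i) x i ln (x i)`. -/
def negEntropy {ι : Type*} [Fintype ι] (η : ι → ℝ) (x : ι → ℝ) : ℝ :=
  ∑ i, 1 / η i * (x i * Real.log (x i))

/-- The Bregman divergence `ψ(x) - ψ(y) - ⟨∇ψ(y), x - y⟩` of `negEntropy η`. -/
def bregman {ι : Type*} [Fintype ι] (η : ι → ℝ) (x y : ι → ℝ) : ℝ :=
  negEntropy η x - negEntropy η y - ∑ i, 1 / η i * (Real.log (y i) + 1) * (x i - y i)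

section Model

variable {S : Type u} {A : S → Type v}

/-- The list of the state-action pairs visited in an episode, in order. A list stands for an
episode that reaches the goal right after its last entry. -/
abbrev Traj (A : S → Type v) : Type (max u v) := List (Σ s, A s)

/-- The state in which a (remaining) trajectory starts; the goal if there is no step left. -/
def startState : Traj A → Option S
  | [] => none
  | x :: _ => some x.1

/-- The sum of the costs along a trajectory. -/
def trajCost (c : (Σ s, A s) → ℝ) (τ : Traj A) : ℝ := (τ.map c).sum

variable [Fintype S] [DecidableEq S] [∀ s, Fintype (A s)] (M : SSP S A)

/-- Product of the action and transition probabilities along a trajectory, including the last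
transition to the goal. -/
def trajWeight (π : (s : S) → A s → ℝ) : Traj A → ℝ
  | [] => 1
  | x :: τ => π x.1 x.2 * M.P x.1 x.2 (startState τ) * trajWeight π τ

/-- The probability that executing the stationary policy `π` from state `s` reaches the goal and
that the episode is exactly `τ`. -/
def trajProb (π : (s : S) → A s → ℝ) (s : S) (τ : Traj A) : ℝ :=
  if startState τ = some s then M.trajWeight π τ else 0

open Classical in
/-- A deterministic policy, as a stationary policy. -/
def detPolicy (π : (s : S) → A s) (s : S) (a : A s) : ℝ := if a = π s then 1 else 0

/-- A deterministic policy is proper if from every state the goal is reached in finitely many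
steps with probability one. -/
def IsProper (π : (s : S) → A s) : Prop :=
  ∀ s, HasSum (M.trajProb (detPolicy π) s) 1

/-- The expected hitting time `T^π(s)` of a proper policy. -/
def hittingTime (π : (s : S) → A s) (s : S) : ℝ :=
  ∑' τ, M.trajProb (detPolicy π) s τ * (τ.length : ℝ)

/-- The cost-to-go `J^π(s)` of a proper policy for the cost function `c`. -/
def costToGo (c : (Σ s, A s) → ℝ) (π : (s : S) → A s) (s : S) : ℝ :=
  ∑' τ, M.trajProb (detPolicy π) s τ * trajCost c τ

/-- The smallest expected hitting time from `s`, which is that of the fast policy. -/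
def fastTime (s : S) : ℝ :=
  ⨅ π : {π : (s : S) → A s // M.IsProper π}, M.hittingTime π.1 s

/-- The diameter `D`. -/
def diameter : ℝ := ⨆ s, M.fastTime s

/-- `π` is a best deterministic proper policy in hindsight for the cost functions in `cs`. -/
def IsBestInHindsight (cs : List ((Σ s, A s) → ℝ)) (π : (s : S) → A s) : Prop :=
  M.IsProper π ∧ ∀ π' : (s : S) → A s, M.IsProper π' →
    (cs.map fun c => M.costToGo c π M.init).sum ≤ (cs.map fun c => M.costToGo c π' M.init).sum

/-- The set `Δ(T)` of functions `q ≥ 0` on state-action pairs that satisfy the flow constraints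
and have total mass at most `T`. -/
def occupancySet (T : ℝ) : Set ((Σ s, A s) → ℝ) :=
  {q | (∀ x, 0 ≤ q x) ∧ ∑ x, q x ≤ T ∧
    ∀ s, ∑ a, q ⟨s, a⟩ - ∑ x : Σ s, A s, M.P x.1 x.2 (some s) * q x
      = if s = M.init then 1 else 0}

/-- The policy `π_q(a | s) ∝ q(s, a)`; uniform in the states with `q(s, ·) = 0`, which an episode
that starts in the initial state never visits when `q` lies in an `occupancySet`. -/
def inducedPolicy (q : (Σ s, A s) → ℝ) (s : S) (a : A s) : ℝ :=
  if ∑ a', q ⟨s, a'⟩ = 0 then 1 / (Fintype.card (A s) : ℝ) else q ⟨s, a⟩ / ∑ a', q ⟨s, a'⟩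

/-- The learning rate `min {1/2, √(T ln (S A T) / (D K))}` of a worker with size parameter `T`;
the number of state-action pairs is `S A`. -/
def workerRate (K : ℕ) (T : ℝ) : ℝ :=
  min (1 / 2) √(T * Real.log (Fintype.card (Σ s, A s) * T) / (M.diameter * K))

/-- The iterate of the worker with size parameter `T` (entropic online mirror descent over
`Δ(T)`) after the cost functions in the list, the most recent one first. -/
def worker (K : ℕ) (T : ℝ) : List ((Σ s, A s) → ℝ) → (Σ s, A s) → ℝ
  | [] => argminOn (M.occupancySet T) (negEntropy fun _ => M.workerRate K T)
  | c :: cs => argminOn (M.occupancySet T) fun q =>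
      ∑ x, q x * c x + bregman (fun _ => M.workerRate K T) q (worker K T cs)

/-- `⌈log₂ T^{π^f}(s₀)⌉`, the exponent of the smallest grid point. -/
def gridBase : ℕ := ⌈Real.logb 2 (M.fastTime M.init)⌉₊

/-- The grid of hitting-time bounds `2 ^ (⌈log₂ T^{π^f}(s₀)⌉ + j)`, counted from `j = 0`. -/
def grid (j : ℕ) : ℝ := 2 ^ (M.gridBase + j)

/-- The number of grid points, such that the largest one is `2 ^ ⌈log₂ B⌉`. -/
def gridSize (B : ℝ) : ℕ := ⌈Real.logb 2 B⌉₊ + 1 - M.gridBase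

/-- The learning rates of the meta algorithm. -/
def metaRate (K : ℕ) (j : ℕ) : ℝ := 1 / √(32 * M.diameter * K * M.grid j)

/-- The initial weights: `η j / (N η 0)` for `j ≠ 0`, and the remaining mass for `j = 0`. -/
def metaInit (K N : ℕ) (j : Fin N) : ℝ :=
  if j.1 = 0 then
    1 - ∑ i : Fin N, if i.1 = 0 then 0 else M.metaRate K i / (N * M.metaRate K 0)
  else M.metaRate K j / (N * M.metaRate K 0)

/-- The loss `ℓ(j) = ⟨q^j, c⟩` of the worker `j` for the cost function `c` that follows `cs`. -/
def workerLoss (K : ℕ) (cs : List ((Σ s, A s) → ℝ)) (c : (Σ s, A s) → ℝ) (j : ℕ) : ℝ :=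
  ∑ x, M.worker K (M.grid j) cs x * c x

/-- The distribution over `N` workers after the cost functions in the list, the most recent one
first: mirror descent with the multi-scale entropy on the losses `ℓ(j) + 4 η j ℓ(j)²`. -/
def metaWeights (K N : ℕ) : List ((Σ s, A s) → ℝ) → Fin N → ℝ
  | [] => M.metaInit K N
  | c :: cs => argminOn (stdSimplex ℝ (Fin N)) fun p =>
      ∑ j : Fin N, p j *
          (M.workerLoss K cs c j + 4 * M.metaRate K j * M.workerLoss K cs c j ^ 2)
        + bregman (fun j : Fin N => M.metaRate K j) p (metaWeights K N cs)

end Model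

section Interaction

variable {S : Type u} {A : S → Type v}

/-- What happened in the past episodes, the most recent one first: the sampled worker and the
trajectory of every episode. -/
abbrev History (A : S → Type v) (N : ℕ) : Type (max u v) := List (Fin N × Traj A)

/-- An adaptive environment: the cost function of an episode as a function of everything that
happened before that episode. -/
abbrev Adversary (A : S → Type v) (N : ℕ) : Type (max u v) :=
  History A N → (Σ s, A s) → ℝ

/-- The cost functions `c_k, …, c_1` chosen along a history of `k` episodes. -/
def costs {N : ℕ} (adv : Adversary A N) : History A N → List ((Σ s, A s) → ℝ)
  | [] => []
  | _ :: h => adv h :: costs adv h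

/-- The total cost of the learner along a history. -/
def learnerCost {N : ℕ} (adv : Adversary A N) : History A N → ℝ
  | [] => 0
  | e :: h => trajCost (adv h) e.2 + learnerCost adv h

variable [Fintype S] [DecidableEq S] [∀ s, Fintype (A s)] (M : SSP S A)

/-- The probability of a history: in every episode the meta algorithm samples a worker `j` from
its current weights and executes the policy induced by the current iterate of that worker. -/
def historyProb (K : ℕ) {N : ℕ} (adv : Adversary A N) : History A N → ℝ
  | [] => 1
  | e :: h => historyProb K adv h * (M.metaWeights K N (costs adv h) e.1 *
      M.trajProb (inducedPolicy (M.worker K (M.grid e.1) (costs adv h))) M.init e.2)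

/-- The regret along a history with respect to the policy `π`. -/
def regret {N : ℕ} (adv : Adversary A N) (π : (s : S) → A s) (h : History A N) : ℝ :=
  learnerCost adv h - ((costs adv h).map fun c => M.costToGo c π M.init).sum

end Interaction

end SSP

end

noncomputable section

set_option linter.unusedSectionVars false

namespace SSP

/-! The regret bound is pathwise first and averaged only at the end. Workers and meta weights are
deterministic functions of the list of past costs, so `cumMetaLoss_sub_best_le` holds for every cost
list of length `K`. The adversary may therefore be adaptive, and the best policy in hindsight may
depend on the whole history.

Write `X = D K`. A single worker with bound `T` runs entropic mirror descent over `Δ(T)`. Since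
costs lie in `[0, 1]`, `c² ≤ c` and the stability term is proportional to the worker's own
cumulative loss (`cumWorkerLoss_sub_le_bregman`). A best policy costs at most as much as the fast
policy, hence at most `X`, so tuning the rate gives regret of order `√(T X)` up to a logarithm
(`cumWorkerLoss_sub_le`).

The meta algorithm competes with every worker at that worker's own scale. The correction `4 η ℓ²`
cancels the second-order terms of all workers and leaves only that of the comparator
(`cumMetaLoss_sub_le_bregman`). Some grid point lies within a factor 2 above `T⋆` if `T⋆ ≤ B`, which
yields `cumMetaLoss_sub_le`. If instead `T⋆ ≥ D K`, the target `√(D T⋆ K)` is at least `X`, and the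
bound against the fast policy is enough.

Finally, executing the policy induced by `q ∈ Δ(T)` ends almost surely and costs at most `⟨q, c⟩` in
expectation (`hasSum_trajProb_inducedPolicy`, `tsum_cost_inducedPolicy_le`). Conditioning on the
past episode by episode, the expected learner cost is at most the expected meta loss
(`expectation_learnerCost_le`). -/

theorem argminOn_spec {ι : Type*} {s : Set (ι → ℝ)} {f : (ι → ℝ) → ℝ} (hs : IsCompact s)
    (hne : s.Nonempty) (hf : Continuous f) :
    argminOn s f ∈ s ∧ IsMinOn f s (argminOn s f) :=
  Classical.epsilon_spec (p := fun x => x ∈ s ∧ IsMinOn f s x)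
    (hs.exists_isMinOn hne hf.continuousOn)

/-! ### Entropic mirror descent with coordinatewise rates over a convex set -/

section Entropy

variable {ι : Type*} [Fintype ι]

theorem continuous_negEntropy (η : ι → ℝ) : Continuous (negEntropy η) := by
  unfold negEntropy
  refine continuous_finsetSum _ fun i _ => continuous_const.mul ?_
  exact Real.continuous_mul_log.comp (continuous_apply i)

theorem continuous_bregman_left (η : ι → ℝ) (y : ι → ℝ) :
    Continuous fun x => bregman η x y := by
  unfold bregman
  have := continuous_negEntropy η
  fun_prop

theorem continuous_linear_add_bregman (η c y : ι → ℝ) :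
    Continuous fun x : ι → ℝ => ∑ i, x i * c i + bregman η x y := by
  have := continuous_bregman_left η y
  fun_prop

/-- The tangent inequality of `x ↦ x * log x`. -/
theorem mul_log_le_mul_log_add {x y : ℝ} (hx : 0 ≤ x) (hy : 0 < y) :
    x * Real.log y ≤ x * Real.log x + y - x := by
  rcases hx.eq_or_lt with rfl | hx
  · simp [hy.le]
  · have h := Real.log_le_sub_one_of_pos (div_pos hy hx)
    rw [Real.log_div hy.ne' hx.ne'] at h
    have h2 := mul_le_mul_of_nonneg_left h hx.le
    have h3 : x * (y / x - 1) = y - x := by field_simp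
    nlinarith

/-- The summand of the Bregman divergence for the rate `1`. -/
def bregmanTerm (x y : ℝ) : ℝ :=
  x * Real.log x - y * Real.log y - (Real.log y + 1) * (x - y)

theorem bregman_eq_sum (η x y : ι → ℝ) :
    bregman η x y = ∑ i, 1 / η i * bregmanTerm (x i) (y i) := by
  unfold bregman negEntropy bregmanTerm
  rw [← Finset.sum_sub_distrib, ← Finset.sum_sub_distrib]
  exact Finset.sum_congr rfl fun i _ => by ring

/-- The support condition replaces an infinite divergence: with `log 0 = 0` the term at `y = 0` is
`x log x - x`, which is negative for `0 < x < e`. -/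
theorem bregmanTerm_nonneg {x y : ℝ} (hx : 0 ≤ x) (hy : 0 ≤ y) (h : y = 0 → x = 0) :
    0 ≤ bregmanTerm x y := by
  unfold bregmanTerm
  rcases hy.eq_or_lt with rfl | hy
  · simp [h rfl]
  · nlinarith [mul_log_le_mul_log_add hx hy]

theorem bregman_nonneg {η x y : ι → ℝ} (hη : ∀ i, 0 < η i) (hx : ∀ i, 0 ≤ x i)
    (hy : ∀ i, 0 ≤ y i) (h : ∀ i, y i = 0 → x i = 0) : 0 ≤ bregman η x y := by
  rw [bregman_eq_sum]
  exact Finset.sum_nonneg fun i _ =>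
    mul_nonneg (one_div_nonneg.2 (hη i).le) (bregmanTerm_nonneg (hx i) (hy i) (h i))

/-- Follows from `exp z ≥ 1 + z + z²/2` and `(1 + z + z²/2)(1 - z + z²/2) = 1 + z⁴/4 ≥ 1`. -/
theorem exp_neg_le_quadratic {z : ℝ} (hz : 0 ≤ z) : Real.exp (-z) ≤ 1 - z + z ^ 2 / 2 := by
  have h1 := Real.quadratic_le_exp_of_nonneg hz
  rw [Real.exp_neg, inv_le_comm₀ (Real.exp_pos z) (by nlinarith [sq_nonneg (z - 1)])]
  refine le_trans ?_ h1
  rw [inv_le_iff_one_le_mul₀ (by nlinarith [sq_nonneg (z - 1)])]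
  nlinarith [sq_nonneg (z ^ 2)]

/-- The stability of one coordinate of an entropic mirror descent step. -/
theorem mul_sub_sub_bregmanTerm_le {x y z : ℝ} (hx : 0 ≤ x) (hy : 0 ≤ y) (hz : 0 ≤ z)
    (h : y = 0 → x = 0) : z * (y - x) - bregmanTerm x y ≤ y * z ^ 2 / 2 := by
  unfold bregmanTerm
  rcases hy.eq_or_lt with rfl | hy
  · simp [h rfl]
  -- The left-hand side is maximal at `x = y exp (-z)`, so the tangent is taken there.
  · have h1 := mul_log_le_mul_log_add hx (mul_pos hy (Real.exp_pos (-z)))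
    rw [Real.log_mul hy.ne' (Real.exp_pos _).ne', Real.log_exp] at h1
    have h2 := mul_le_mul_of_nonneg_left (exp_neg_le_quadratic hz) hy.le
    nlinarith

/-- The slope of the entropy along a segment at an intermediate point. -/
theorem optimality_on_segment {C : Set (ι → ℝ)} (hC : Convex ℝ C) (hpos : ∀ x ∈ C, ∀ i, 0 ≤ x i)
    {η g z u : ι → ℝ} (hη : ∀ i, 0 < η i) (hz : z ∈ C)
    (hmin : IsMinOn (fun q => ∑ i, q i * g i + negEntropy η q) C z) (hu : u ∈ C)
    {t : ℝ} (ht0 : 0 < t) (ht1 : t < 1) :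
    0 ≤ ∑ i, (g i + 1 / η i * (Real.log (z i + t * (u i - z i)) + 1)) * (u i - z i) := by
  set w : ι → ℝ := fun i => z i + t * (u i - z i) with hw
  have hwC : w ∈ C := by
    have := hC hz hu (by linarith : 0 ≤ 1 - t) ht0.le (by ring)
    convert this using 1
    ext i
    simp [hw]; ring
  have h0 := hmin hwC
  simp only [Set.mem_ofPred_eq, negEntropy] at h0
  rw [← Finset.sum_add_distrib, ← Finset.sum_add_distrib] at h0
  have key : ∀ i, (w i * g i + 1 / η i * (w i * Real.log (w i)))
      - (z i * g i + 1 / η i * (z i * Real.log (z i)))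
      ≤ t * ((g i + 1 / η i * (Real.log (w i) + 1)) * (u i - z i)) := by
    intro i
    have hzi := hpos z hz i
    have hui := hpos u hu i
    have hd : t * (u i - z i) = w i - z i := by simp [hw]
    have hmain : w i * Real.log (w i) - z i * Real.log (z i)
        ≤ (Real.log (w i) + 1) * (w i - z i) := by
      rcases (hpos w hwC i).eq_or_lt with h | h
      · have hzz : z i = 0 := by
          have : (1 - t) * z i + t * u i = 0 := by rw [h, hw]; ring
          nlinarith [mul_nonneg ht0.le hui]
        rw [← h, hzz]; simp
      · nlinarith [mul_log_le_mul_log_add hzi h]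
    have h1 := mul_le_mul_of_nonneg_left hmain (one_div_nonneg.2 (hη i).le)
    calc _ = (w i - z i) * g i
          + 1 / η i * (w i * Real.log (w i) - z i * Real.log (z i)) := by ring
      _ ≤ (w i - z i) * g i + 1 / η i * ((Real.log (w i) + 1) * (w i - z i)) := by linarith
      _ = _ := by rw [← hd]; ring
  have hsum := Finset.sum_le_sum fun i (_ : i ∈ Finset.univ) => key i
  rw [Finset.sum_sub_distrib, ← Finset.mul_sum] at hsum
  exact nonneg_of_mul_nonneg_right (by linarith) ht0

/-- A minimizer of a linear function plus the entropy has full support. -/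
theorem support_of_isMinOn {C : Set (ι → ℝ)} (hC : Convex ℝ C) (hpos : ∀ x ∈ C, ∀ i, 0 ≤ x i)
    {η g z u : ι → ℝ} (hη : ∀ i, 0 < η i) (hz : z ∈ C)
    (hmin : IsMinOn (fun q => ∑ i, q i * g i + negEntropy η q) C z) (hu : u ∈ C)
    (i : ι) (hzi : z i = 0) : u i = 0 := by
  classical
  by_contra hui
  have hui : 0 < u i := lt_of_le_of_ne (hpos u hu i) (Ne.symm hui)
  -- `h j t` is the contribution of coordinate `j` to the slope from `z` towards `u`. Each is
  -- nondecreasing in `t`, so the other coordinates stay below their values at `1/2`, whereas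
  -- coordinate `i` contains `log (t u i)` and tends to `-∞` as `t → 0`. This contradicts a
  -- nonnegative total slope.
  set h : ι → ℝ → ℝ := fun j t =>
    (g j + 1 / η j * (Real.log (z j + t * (u j - z j)) + 1)) * (u j - z j) with hh
  have hmono : ∀ j, ∀ t : ℝ, 0 < t → t ≤ 1 / 2 → h j t ≤ h j (1 / 2) := by
    intro j t ht0 ht
    have hzj := hpos z hz j
    have huj := hpos u hu j
    have hηj := one_div_pos.2 (hη j)
    simp only [hh]
    rcases lt_trichotomy (u j) (z j) with hlt | heq | hgt
    · have : Real.log (z j + 1 / 2 * (u j - z j)) ≤ Real.log (z j + t * (u j - z j)) :=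
        Real.log_le_log (by nlinarith) (by nlinarith)
      have := mul_le_mul_of_nonneg_left this hηj.le
      exact mul_le_mul_of_nonpos_right (by nlinarith) (by linarith)
    · simp [heq]
    · have : Real.log (z j + t * (u j - z j)) ≤ Real.log (z j + 1 / 2 * (u j - z j)) :=
        Real.log_le_log (by nlinarith) (by nlinarith)
      have := mul_le_mul_of_nonneg_left this hηj.le
      exact mul_le_mul_of_nonneg_right (by nlinarith) (by linarith)
  have hlow : ∀ t : ℝ, 0 < t → t ≤ 1 / 2 →
      -(∑ j ∈ Finset.univ.erase i, h j (1 / 2)) ≤ h i t := by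
    intro t ht0 ht
    have h1 : 0 ≤ ∑ j, h j t := optimality_on_segment hC hpos hη hz hmin hu ht0 (by linarith)
    rw [← Finset.add_sum_erase _ _ (Finset.mem_univ i)] at h1
    have h2 := Finset.sum_le_sum fun j (_ : j ∈ Finset.univ.erase i) => hmono j t ht0 ht
    linarith
  have hlog : Filter.Tendsto (fun t : ℝ => Real.log (t * u i)) (nhdsWithin 0 (Set.Ioi 0))
      Filter.atBot := by
    refine Real.tendsto_log_nhdsGT_zero.comp ?_
    refine tendsto_nhdsWithin_iff.2 ⟨?_, ?_⟩
    · have : Filter.Tendsto (fun t : ℝ => t * u i) (nhds 0) (nhds (0 * u i)) :=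
        (continuous_id.mul continuous_const).tendsto 0
      rw [zero_mul] at this
      exact this.mono_left nhdsWithin_le_nhds
    · filter_upwards [self_mem_nhdsWithin] with t ht using mul_pos ht hui
  set m := -(∑ j ∈ Finset.univ.erase i, h j (1 / 2))
  have hev := hlog.eventually (Filter.eventually_lt_atBot (((m / u i - g i) * η i) - 1))
  have hhalf : ∀ᶠ t : ℝ in nhdsWithin 0 (Set.Ioi 0), t ∈ Set.Ioc (0 : ℝ) (1 / 2) :=
    Ioc_mem_nhdsGT (by norm_num)
  obtain ⟨t, ht1, ht2⟩ := (hev.and hhalf).exists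
  have h3 := hlow t ht2.1 ht2.2
  simp only [hh, hzi, sub_zero, zero_add] at h3
  have h4 : 1 / η i * (Real.log (t * u i) + 1) < m / u i - g i := by
    rw [one_div, inv_mul_lt_iff₀ (hη i)]
    linarith
  have h5 : (g i + 1 / η i * (Real.log (t * u i) + 1)) * u i < m := by
    rw [← lt_div_iff₀ hui]; linarith
  linarith

/-- The first-order optimality condition for a linear function plus the entropy. -/
theorem first_order_of_isMinOn {C : Set (ι → ℝ)} (hC : Convex ℝ C)
    (hpos : ∀ x ∈ C, ∀ i, 0 ≤ x i) {η g z u : ι → ℝ} (hη : ∀ i, 0 < η i) (hz : z ∈ C)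
    (hmin : IsMinOn (fun q => ∑ i, q i * g i + negEntropy η q) C z) (hu : u ∈ C) :
    0 ≤ ∑ i, (g i + 1 / η i * (Real.log (z i) + 1)) * (u i - z i) := by
  have hlim : Filter.Tendsto (fun t : ℝ =>
      ∑ i, (g i + 1 / η i * (Real.log (z i + t * (u i - z i)) + 1)) * (u i - z i))
      (nhdsWithin 0 (Set.Ioi 0))
      (nhds (∑ i, (g i + 1 / η i * (Real.log (z i) + 1)) * (u i - z i))) := by
    refine tendsto_finsetSum _ fun i _ => ?_
    rcases (hpos z hz i).eq_or_lt with h | h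
    -- Where the logarithm is singular, full support forces `u i = z i = 0` and the summand
    -- vanishes.
    · simp [← h, support_of_isMinOn hC hpos hη hz hmin hu i h.symm]
    · have hc : ContinuousAt (fun t : ℝ =>
          (g i + 1 / η i * (Real.log (z i + t * (u i - z i)) + 1)) * (u i - z i)) 0 := by
        have : ContinuousAt (fun t : ℝ => Real.log (z i + t * (u i - z i))) 0 :=
          ContinuousAt.log (by fun_prop) (by simpa using h.ne')
        fun_prop
      have := hc.tendsto
      simp only [zero_mul, add_zero] at this
      exact this.mono_left nhdsWithin_le_nhds
  refine ge_of_tendsto hlim ?_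
  filter_upwards [Ioo_mem_nhdsGT (show (0 : ℝ) < 1 by norm_num)] with t ht
  exact optimality_on_segment hC hpos hη hz hmin hu ht.1 ht.2

/-- The divergence from a fixed `y` differs from the entropy by an affine function of `q`. This
brings a mirror descent step into the form required by the support and first-order lemmas. -/
theorem isMinOn_of_linear_add_bregman {C : Set (ι → ℝ)} {η c y z : ι → ℝ}
    (hmin : IsMinOn (fun q => ∑ i, q i * c i + bregman η q y) C z) :
    IsMinOn (fun q => ∑ i, q i * (c i - 1 / η i * (Real.log (y i) + 1)) + negEntropy η q)
      C z := by
  have key : ∀ q : ι → ℝ, ∑ i, q i * (c i - 1 / η i * (Real.log (y i) + 1)) + negEntropy η q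
      = (∑ i, q i * c i + bregman η q y) + (negEntropy η y
        - ∑ i, 1 / η i * (Real.log (y i) + 1) * y i) := by
    intro q
    have h1 : ∑ i, q i * (c i - 1 / η i * (Real.log (y i) + 1))
        = ∑ i, q i * c i - ∑ i, 1 / η i * (Real.log (y i) + 1) * (q i - y i)
          - ∑ i, 1 / η i * (Real.log (y i) + 1) * y i := by
      rw [← Finset.sum_sub_distrib, ← Finset.sum_sub_distrib]
      exact Finset.sum_congr rfl fun i _ => by ring
    rw [h1, bregman]; ring
  intro q hq
  have := hmin hq
  simp only [Set.mem_ofPred_eq] at this ⊢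
  rw [key, key]
  linarith

/-- One step of entropic mirror descent. -/
theorem mirror_descent_step {C : Set (ι → ℝ)} (hC : Convex ℝ C)
    (hpos : ∀ x ∈ C, ∀ i, 0 ≤ x i) {η c y z u : ι → ℝ} (hη : ∀ i, 0 < η i)
    (hc : ∀ i, 0 ≤ c i) (hy : ∀ i, 0 ≤ y i) (hsupp : ∀ x ∈ C, ∀ i, y i = 0 → x i = 0)
    (hz : z ∈ C) (hmin : IsMinOn (fun q => ∑ i, q i * c i + bregman η q y) C z) (hu : u ∈ C) :
    ∑ i, y i * c i - ∑ i, u i * c i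
      ≤ bregman η u y - bregman η u z + ∑ i, η i / 2 * (y i * c i ^ 2) := by
  have h1 := first_order_of_isMinOn hC hpos hη hz (isMinOn_of_linear_add_bregman hmin) hu
  rw [bregman_eq_sum, bregman_eq_sum, ← Finset.sum_sub_distrib, ← Finset.sum_sub_distrib,
    ← Finset.sum_add_distrib]
  rw [← add_zero (∑ i, (y i * c i - u i * c i))]
  refine (add_le_add_right h1 _).trans ?_
  rw [← Finset.sum_add_distrib]
  refine Finset.sum_le_sum fun i _ => ?_
  have h2 := mul_sub_sub_bregmanTerm_le (hpos z hz i) (hy i) (mul_nonneg (hη i).le (hc i))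
    (hsupp z hz i)
  have h3 := mul_le_mul_of_nonneg_left h2 (one_div_nonneg.2 (hη i).le)
  have hηi := (hη i).ne'
  have h4 : 1 / η i * (η i * c i * (y i - z i) - bregmanTerm (z i) (y i))
      = c i * (y i - z i) - 1 / η i * bregmanTerm (z i) (y i) := by field_simp
  have h5 : 1 / η i * (y i * (η i * c i) ^ 2 / 2) = η i / 2 * (y i * c i ^ 2) := by field_simp
  rw [h4, h5] at h3
  -- Three-point identity: the first-order condition controls the first summand, the stability bound
  -- `h3` the second.
  have h6 : bregmanTerm (u i) (y i) - bregmanTerm (u i) (z i)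
      = (Real.log (z i) - Real.log (y i)) * (u i - z i) + bregmanTerm (z i) (y i) := by
    unfold bregmanTerm; ring
  have h7 : 1 / η i * bregmanTerm (u i) (y i) - 1 / η i * bregmanTerm (u i) (z i)
      = 1 / η i * (Real.log (z i) - Real.log (y i)) * (u i - z i)
        + 1 / η i * bregmanTerm (z i) (y i) := by
    rw [← mul_sub, h6]; ring
  rw [h7]
  linarith

end Entropy

/-! ### Expectations over finite episodes as limits of truncations by length -/

section Trajectories

variable {S : Type*} {A : S → Type*} [Fintype S] [∀ s, Fintype (A s)]

open Classical in
/-- The lists of length at most `n`. -/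
def listsUpTo (α : Type*) [Fintype α] : ℕ → Finset (List α)
  | 0 => {[]}
  | n + 1 => insert [] ((Finset.univ ×ˢ listsUpTo α n).image fun p => p.1 :: p.2)

theorem mem_listsUpTo {α : Type*} [Fintype α] (n : ℕ) (l : List α) :
    l ∈ listsUpTo α n ↔ l.length ≤ n := by
  induction n generalizing l with
  | zero => simp [listsUpTo]
  | succ n ih =>
    cases l with
    | nil => simp [listsUpTo]
    | cons a l => simp [listsUpTo, ih]

theorem sum_listsUpTo_succ {α : Type*} [Fintype α] (n : ℕ) (f : List α → ℝ) :
    ∑ l ∈ listsUpTo α (n + 1), f l = f [] + ∑ a, ∑ l ∈ listsUpTo α n, f (a :: l) := by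
  classical
  rw [listsUpTo, Finset.sum_insert (by simp), Finset.sum_image, Finset.sum_product]
  rintro ⟨a, l⟩ _ ⟨b, m⟩ _ h
  simpa using h

theorem monotone_listsUpTo (α : Type*) [Fintype α] : Monotone (listsUpTo α) := by
  intro m n hmn l hl
  rw [mem_listsUpTo] at hl ⊢
  omega

/-- Cofinality makes an unconditional sum over all episodes the limit, in the length bound, of
finite sums that obey one-step recursions. -/
theorem tendsto_listsUpTo (α : Type*) [Fintype α] :
    Filter.Tendsto (listsUpTo α) Filter.atTop Filter.atTop :=
  Filter.tendsto_atTop_finset_of_monotone (monotone_listsUpTo α)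
    fun l => ⟨l.length, (mem_listsUpTo _ _).2 le_rfl⟩

theorem summable_of_sum_listsUpTo_le {α : Type*} [Fintype α] {f : List α → ℝ}
    (hf : ∀ l, 0 ≤ f l) {b : ℝ} (hb : ∀ n, ∑ l ∈ listsUpTo α n, f l ≤ b) : Summable f := by
  refine summable_of_sum_le hf (c := b) fun s => ?_
  obtain ⟨n, hn⟩ := ((tendsto_listsUpTo α).eventually (Filter.eventually_ge_atTop s)).exists
  exact (Finset.sum_le_sum_of_subset_of_nonneg hn fun l _ _ => hf l).trans (hb n)

/-- A stationary randomized policy. -/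
structure IsPolicy (π : (s : S) → A s → ℝ) : Prop where
  nonneg : ∀ s a, 0 ≤ π s a
  sum_eq_one : ∀ s, ∑ a, π s a = 1

theorem isPolicy_detPolicy (π : (s : S) → A s) : IsPolicy (detPolicy π) where
  nonneg s a := by unfold detPolicy; split_ifs <;> norm_num
  sum_eq_one s := by classical simp [detPolicy]

theorem isPolicy_inducedPolicy [∀ s, Nonempty (A s)] {q : (Σ s, A s) → ℝ}
    (hq : ∀ x, 0 ≤ q x) : IsPolicy (inducedPolicy q) where
  nonneg s a := by
    unfold inducedPolicy
    split_ifs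
    · positivity
    · exact div_nonneg (hq _) (Finset.sum_nonneg fun a _ => hq _)
  sum_eq_one s := by
    unfold inducedPolicy
    split_ifs with h
    · simp
    · rw [← Finset.sum_div, div_self h]

theorem sum_mul_inducedPolicy {q : (Σ s, A s) → ℝ} (hq : ∀ x, 0 ≤ q x) (s : S) (a : A s) :
    (∑ a', q ⟨s, a'⟩) * inducedPolicy q s a = q ⟨s, a⟩ := by
  unfold inducedPolicy
  split_ifs with h
  · rw [h, zero_mul]
    exact ((Finset.sum_eq_zero_iff_of_nonneg fun a _ => hq _).1 h a (Finset.mem_univ a)).symm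
  · field_simp

theorem trajCost_nonneg {c : (Σ s, A s) → ℝ} (hc : ∀ x, 0 ≤ c x) (τ : Traj A) :
    0 ≤ trajCost c τ := by
  refine List.sum_nonneg fun y hy => ?_
  obtain ⟨x, _, rfl⟩ := List.mem_map.1 hy
  exact hc x

theorem trajCost_cons (c : (Σ s, A s) → ℝ) (x : Σ s, A s) (τ : Traj A) :
    trajCost c (x :: τ) = c x + trajCost c τ := by simp [trajCost]

variable [DecidableEq S] (M : SSP S A) {π : (s : S) → A s → ℝ}

theorem trajWeight_nonneg (hπ : IsPolicy π) (τ : Traj A) : 0 ≤ M.trajWeight π τ := by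
  induction τ with
  | nil => simp [trajWeight]
  | cons x τ ih => exact mul_nonneg (mul_nonneg (hπ.nonneg _ _) (M.P_nonneg _ _ _)) ih

theorem trajProb_nonneg (hπ : IsPolicy π) (s : S) (τ : Traj A) : 0 ≤ M.trajProb π s τ := by
  unfold trajProb
  split_ifs
  · exact M.trajWeight_nonneg hπ τ
  · exact le_rfl

theorem trajProb_nil (s : S) : M.trajProb π s [] = 0 := by simp [trajProb, startState]

theorem trajProb_cons_self (s : S) (a : A s) (τ : Traj A) :
    M.trajProb π s (⟨s, a⟩ :: τ) = π s a * M.P s a (startState τ) * M.trajWeight π τ :=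
  if_pos rfl

/-- The expectation of `h` over the episodes of at most `n` steps that start in `s`. -/
def truncExp (π : (s : S) → A s → ℝ) (h : Traj A → ℝ) (n : ℕ) (s : S) : ℝ :=
  ∑ τ ∈ listsUpTo (Σ s, A s) n, M.trajProb π s τ * h τ

theorem truncExp_zero (h : Traj A → ℝ) (s : S) : M.truncExp π h 0 s = 0 := by
  simp [truncExp, listsUpTo, trajProb, startState]

/-- First-step analysis: the tail after the first action is empty exactly when the transition leads
to the goal, and otherwise starts in a unique state `s'`. -/
theorem truncExp_succ (h : Traj A → ℝ) (n : ℕ) (s : S) :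
    M.truncExp π h (n + 1) s = ∑ a, π s a * (M.P s a none * h [⟨s, a⟩]
      + ∑ s', M.P s a (some s') * M.truncExp π (fun τ => h (⟨s, a⟩ :: τ)) n s') := by
  classical
  have hstep : ∀ a : A s, ∑ τ ∈ listsUpTo (Σ s, A s) n,
      M.P s a (startState τ) * M.trajWeight π τ * h (⟨s, a⟩ :: τ)
      = M.P s a none * h [⟨s, a⟩]
        + ∑ s', M.P s a (some s') * M.truncExp π (fun τ => h (⟨s, a⟩ :: τ)) n s' := by
    intro a
    have h1 : ∀ τ : Traj A, M.P s a (startState τ) * M.trajWeight π τ * h (⟨s, a⟩ :: τ)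
        = (if τ = [] then M.P s a none * h [⟨s, a⟩] else 0)
          + ∑ s', M.P s a (some s') * (M.trajProb π s' τ * h (⟨s, a⟩ :: τ)) := by
      intro τ
      cases τ with
      | nil => simp [startState, trajWeight, trajProb]
      | cons x τ =>
        simp only [startState, trajProb, Option.some.injEq, reduceCtorEq, if_false, zero_add,
          ite_mul, mul_ite, zero_mul, mul_zero, Finset.sum_ite_eq, Finset.mem_univ, if_true]
        ring
    simp only [h1, Finset.sum_add_distrib, truncExp, Finset.mul_sum]
    rw [Finset.sum_comm, Finset.sum_ite_eq', if_pos ((mem_listsUpTo _ _).2 (by simp))]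
  rw [truncExp, sum_listsUpTo_succ, Fintype.sum_sigma]
  rw [Finset.sum_eq_single s]
  · simp only [trajProb_nil, trajProb_cons_self, zero_mul, zero_add]
    refine Finset.sum_congr rfl fun a _ => ?_
    rw [← hstep, Finset.mul_sum]
    exact Finset.sum_congr rfl fun τ _ => by ring
  · intro s' _ hs'
    refine Finset.sum_eq_zero fun a _ => Finset.sum_eq_zero fun τ _ => ?_
    simp [trajProb, startState, hs']
  · simp

theorem P_none_eq (s : S) (a : A s) : M.P s a none = 1 - ∑ s', M.P s a (some s') := by
  have := M.P_sum s a
  rw [Fintype.sum_option] at this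
  linarith

/-- The probability that an episode from `s` has more than `n` steps. -/
def survival (π : (s : S) → A s → ℝ) (n : ℕ) (s : S) : ℝ := 1 - M.truncExp π (fun _ => 1) n s

theorem survival_zero (s : S) : M.survival π 0 s = 1 := by simp [survival, truncExp_zero]

theorem survival_succ (hπ : IsPolicy π) (n : ℕ) (s : S) :
    M.survival π (n + 1) s = ∑ a, π s a * ∑ s', M.P s a (some s') * M.survival π n s' := by
  unfold survival
  rw [truncExp_succ]
  conv_lhs => enter [1]; rw [← hπ.sum_eq_one s]
  rw [← Finset.sum_sub_distrib]
  refine Finset.sum_congr rfl fun a _ => ?_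
  rw [P_none_eq]
  simp only [mul_sub, mul_one, Finset.sum_sub_distrib]
  ring

theorem survival_nonneg (hπ : IsPolicy π) (n : ℕ) (s : S) : 0 ≤ M.survival π n s := by
  induction n generalizing s with
  | zero => simp [survival_zero]
  | succ n ih =>
    rw [M.survival_succ hπ]
    exact Finset.sum_nonneg fun a _ => mul_nonneg (hπ.nonneg s a)
      (Finset.sum_nonneg fun s' _ => mul_nonneg (M.P_nonneg _ _ _) (ih s'))

theorem truncExp_mono (hπ : IsPolicy π) {h : Traj A → ℝ} (hh : ∀ τ, 0 ≤ h τ) (s : S) :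
    Monotone fun n => M.truncExp π h n s := fun _ _ hmn =>
  Finset.sum_le_sum_of_subset_of_nonneg (monotone_listsUpTo _ hmn)
    fun τ _ _ => mul_nonneg (M.trajProb_nonneg hπ s τ) (hh τ)

theorem truncExp_nonneg (hπ : IsPolicy π) {h : Traj A → ℝ} (hh : ∀ τ, 0 ≤ h τ) (n : ℕ) (s : S) :
    0 ≤ M.truncExp π h n s :=
  Finset.sum_nonneg fun τ _ => mul_nonneg (M.trajProb_nonneg hπ s τ) (hh τ)

theorem truncExp_one_le (hπ : IsPolicy π) (n : ℕ) (s : S) : M.truncExp π (fun _ => 1) n s ≤ 1 :=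
  sub_nonneg.1 (M.survival_nonneg hπ n s)

/-- The cost of the first step counts only on episodes short enough to be included, hence the factor
`truncExp` of the constant 1. -/
theorem truncExp_trajCost_succ (c : (Σ s, A s) → ℝ) (n : ℕ) (s : S) :
    M.truncExp π (trajCost c) (n + 1) s = ∑ a, π s a * (M.P s a none * c ⟨s, a⟩
      + ∑ s', M.P s a (some s') *
        (c ⟨s, a⟩ * M.truncExp π (fun _ => 1) n s' + M.truncExp π (trajCost c) n s')) := by
  rw [truncExp_succ]
  refine Finset.sum_congr rfl fun a _ => ?_
  congr 2
  · simp [trajCost]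
  · refine Finset.sum_congr rfl fun s' _ => ?_
    congr 1
    simp only [truncExp, trajCost_cons, mul_add, Finset.sum_add_distrib, Finset.mul_sum]
    congr 1
    exact Finset.sum_congr rfl fun τ _ => by ring

theorem truncExp_trajCost_succ_le (hπ : IsPolicy π) {c : (Σ s, A s) → ℝ} (hc : ∀ x, 0 ≤ c x)
    (n : ℕ) (s : S) :
    M.truncExp π (trajCost c) (n + 1) s ≤ ∑ a, π s a * (c ⟨s, a⟩
      + ∑ s', M.P s a (some s') * M.truncExp π (trajCost c) n s') := by
  rw [truncExp_trajCost_succ]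
  refine Finset.sum_le_sum fun a _ => mul_le_mul_of_nonneg_left ?_ (hπ.nonneg s a)
  rw [P_none_eq]
  have : ∑ s', M.P s a (some s') *
        (c ⟨s, a⟩ * M.truncExp π (fun _ => 1) n s' + M.truncExp π (trajCost c) n s')
      ≤ ∑ s', (M.P s a (some s') * c ⟨s, a⟩
        + M.P s a (some s') * M.truncExp π (trajCost c) n s') := by
    refine Finset.sum_le_sum fun s' _ => ?_
    rw [← mul_add]
    refine mul_le_mul_of_nonneg_left ?_ (M.P_nonneg _ _ _)
    have := mul_le_mul_of_nonneg_left (M.truncExp_one_le hπ n s') (hc ⟨s, a⟩)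
    linarith
  rw [Finset.sum_add_distrib, ← Finset.sum_mul] at this
  linarith

/-! ### Occupancy sets and the policies they induce -/

section Induced

variable {M} {T : ℝ} {q : (Σ s, A s) → ℝ}

/-- Testing the flow constraint against `f`. -/
theorem sum_flow_mul (hq : q ∈ M.occupancySet T) (f : S → ℝ) :
    ∑ x, q x * ∑ s', M.P x.1 x.2 (some s') * f s' = ∑ s, (∑ a, q ⟨s, a⟩) * f s - f M.init := by
  have h1 : ∑ s, (∑ a, q ⟨s, a⟩ - ∑ x : Σ s, A s, M.P x.1 x.2 (some s) * q x) * f s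
      = f M.init := by
    simp [hq.2.2]
  simp only [sub_mul, Finset.sum_sub_distrib] at h1
  rw [← h1, sub_sub_cancel]
  simp only [Finset.mul_sum, Finset.sum_mul]
  rw [Finset.sum_comm]
  exact Finset.sum_congr rfl fun s _ => Finset.sum_congr rfl fun x _ => by ring

theorem sum_mul_sum_inducedPolicy (hq : ∀ x, 0 ≤ q x) (g : (Σ s, A s) → ℝ) :
    ∑ s, (∑ a, q ⟨s, a⟩) * ∑ a, inducedPolicy q s a * g ⟨s, a⟩ = ∑ x, q x * g x := by
  rw [Fintype.sum_sigma]
  refine Finset.sum_congr rfl fun s _ => ?_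
  rw [Finset.mul_sum]
  refine Finset.sum_congr rfl fun a _ => ?_
  rw [← mul_assoc, sum_mul_inducedPolicy hq]

variable [∀ s, Nonempty (A s)]

/-- With `ρ(s) = ∑ a, q(s, a)` and `V n` the truncated cost, monotonicity and the one-step bound
give `⟨ρ, V n⟩ ≤ ⟨q, c⟩ + ⟨q, P V n⟩`, and the flow constraint rewrites the last term as `⟨ρ, V n⟩ -
V n (init)`. Equality may fail even in the limit, because `q` may carry circulations that an episode
never visits. -/
theorem truncExp_inducedPolicy_le (hq : q ∈ M.occupancySet T) {c : (Σ s, A s) → ℝ}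
    (hc : ∀ x, 0 ≤ c x) (n : ℕ) :
    M.truncExp (inducedPolicy q) (trajCost c) n M.init ≤ ∑ x, q x * c x := by
  have hπ := isPolicy_inducedPolicy hq.1
  set V := M.truncExp (inducedPolicy q) (trajCost c) with hV
  have hρ : ∀ s, 0 ≤ ∑ a, q ⟨s, a⟩ := fun s => Finset.sum_nonneg fun a _ => hq.1 _
  have h1 : ∑ s, (∑ a, q ⟨s, a⟩) * V n s ≤ ∑ s, (∑ a, q ⟨s, a⟩) * V (n + 1) s :=
    Finset.sum_le_sum fun s _ => mul_le_mul_of_nonneg_left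
      (M.truncExp_mono hπ (trajCost_nonneg hc) s n.le_succ) (hρ s)
  have h2 : ∑ s, (∑ a, q ⟨s, a⟩) * V (n + 1) s
      ≤ ∑ s, (∑ a, q ⟨s, a⟩) * ∑ a, inducedPolicy q s a * (c ⟨s, a⟩
      + ∑ s', M.P s a (some s') * V n s') :=
    Finset.sum_le_sum fun s _ => mul_le_mul_of_nonneg_left
      (M.truncExp_trajCost_succ_le hπ hc n s) (hρ s)
  rw [sum_mul_sum_inducedPolicy hq.1
    (fun x => c x + ∑ s', M.P x.1 x.2 (some s') * V n s')] at h2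
  simp only [mul_add, Finset.sum_add_distrib] at h2
  rw [sum_flow_mul hq] at h2
  linarith

/-- Averaging survival against the state mass of `q` gives a nonnegative potential `R n` that drops
by exactly the survival probability from `init`. These probabilities are therefore summable. Only
the initial state is covered; the induced policy need not be proper. -/
theorem survival_inducedPolicy_tendsto (hq : q ∈ M.occupancySet T) :
    Filter.Tendsto (fun n => M.survival (inducedPolicy q) n M.init) Filter.atTop (nhds 0) := by
  have hπ := isPolicy_inducedPolicy hq.1
  set U := M.survival (inducedPolicy q) with hU
  have hρ : ∀ s, 0 ≤ ∑ a, q ⟨s, a⟩ := fun s => Finset.sum_nonneg fun a _ => hq.1 _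
  set R : ℕ → ℝ := fun n => ∑ s, (∑ a, q ⟨s, a⟩) * U n s with hR
  have hstep : ∀ n, U n M.init = R n - R (n + 1) := by
    intro n
    have : R (n + 1) = ∑ x, q x * ∑ s', M.P x.1 x.2 (some s') * U n s' := by
      rw [← sum_mul_sum_inducedPolicy hq.1
        (fun x => ∑ s', M.P x.1 x.2 (some s') * U n s')]
      exact Finset.sum_congr rfl fun s _ => by rw [hU, M.survival_succ hπ]
    rw [this, sum_flow_mul hq]
    simp [hR]
  have hsum : Summable fun n => U n M.init := by
    refine summable_of_sum_range_le (c := R 0) (fun n => M.survival_nonneg hπ n _) fun n => ?_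
    simp only [hstep]
    rw [Finset.sum_range_sub']
    have : 0 ≤ R n := Finset.sum_nonneg fun s _ => mul_nonneg (hρ s) (M.survival_nonneg hπ n s)
    linarith
  exact hsum.tendsto_atTop_zero

theorem hasSum_trajProb_of_survival {π : (s : S) → A s → ℝ} (hπ : IsPolicy π) {s : S}
    (h : Filter.Tendsto (fun n => M.survival π n s) Filter.atTop (nhds 0)) :
    HasSum (M.trajProb π s) 1 := by
  have hs : Summable (M.trajProb π s) := by
    refine summable_of_sum_listsUpTo_le (M.trajProb_nonneg hπ s) (b := 1) fun n => ?_
    have := M.truncExp_one_le hπ n s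
    simpa [truncExp] using this
  have h1 := hs.hasSum.comp (tendsto_listsUpTo _)
  have h2 : Filter.Tendsto (fun n => 1 - M.survival π n s) Filter.atTop (nhds (1 - 0)) :=
    tendsto_const_nhds.sub h
  have h3 : (fun n => 1 - M.survival π n s)
      = (fun F => ∑ τ ∈ F, M.trajProb π s τ) ∘ listsUpTo (Σ s, A s) := by
    ext n; simp [survival, truncExp]
  rw [h3, sub_zero] at h2
  rw [← tendsto_nhds_unique h1 h2]
  exact hs.hasSum

theorem hasSum_trajProb_inducedPolicy (hq : q ∈ M.occupancySet T) :
    HasSum (M.trajProb (inducedPolicy q) M.init) 1 :=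
  hasSum_trajProb_of_survival (isPolicy_inducedPolicy hq.1) (survival_inducedPolicy_tendsto hq)

theorem summable_cost_inducedPolicy (hq : q ∈ M.occupancySet T) {c : (Σ s, A s) → ℝ}
    (hc : ∀ x, 0 ≤ c x) :
    Summable fun τ => M.trajProb (inducedPolicy q) M.init τ * trajCost c τ :=
  summable_of_sum_listsUpTo_le (fun τ => mul_nonneg
    (M.trajProb_nonneg (isPolicy_inducedPolicy hq.1) _ τ) (trajCost_nonneg hc τ))
    (truncExp_inducedPolicy_le hq hc)

/-- The expected cost of the induced policy is at most that of the occupancy vector. -/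
theorem tsum_cost_inducedPolicy_le (hq : q ∈ M.occupancySet T) {c : (Σ s, A s) → ℝ}
    (hc : ∀ x, 0 ≤ c x) :
    ∑' τ, M.trajProb (inducedPolicy q) M.init τ * trajCost c τ ≤ ∑ x, q x * c x :=
  le_of_tendsto' ((summable_cost_inducedPolicy hq hc).hasSum.comp (tendsto_listsUpTo _))
    (truncExp_inducedPolicy_le hq hc)

end Induced

/-! ### Proper policies -/

section Proper

variable {M} {π : (s : S) → A s}

theorem sum_detPolicy_mul (π : (s : S) → A s) (s : S) (f : A s → ℝ) :
    ∑ a, detPolicy π s a * f a = f (π s) := by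
  classical simp [detPolicy]

theorem IsProper.survival_tendsto (hπ : M.IsProper π) (s : S) :
    Filter.Tendsto (fun n => M.survival (detPolicy π) n s) Filter.atTop (nhds 0) := by
  have h1 := (hπ s).comp (tendsto_listsUpTo _)
  have h2 : Filter.Tendsto (fun n => 1 - ∑ τ ∈ listsUpTo (Σ s, A s) n,
      M.trajProb (detPolicy π) s τ) Filter.atTop (nhds (1 - 1)) := tendsto_const_nhds.sub h1
  simpa [survival, truncExp] using h2

/-- A harmonic function of a proper policy vanishes. -/
theorem IsProper.eq_zero_of_harmonic (hπ : M.IsProper π) {g : S → ℝ}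
    (hg : ∀ s, g s = ∑ s', M.P s (π s) (some s') * g s') : g = 0 := by
  have hG : ∀ s, |g s| ≤ ∑ s', |g s'| := fun s =>
    Finset.single_le_sum (f := fun s' => |g s'|) (fun _ _ => abs_nonneg _) (Finset.mem_univ s)
  set G := ∑ s', |g s'|
  -- Iterating harmonicity `n` times leaves only episodes that have not ended after `n` steps.
  have hle : ∀ n s, |g s| ≤ G * M.survival (detPolicy π) n s := by
    intro n
    induction n with
    | zero => intro s; simpa [survival_zero] using hG s
    | succ n ih =>
      intro s
      rw [hg s, M.survival_succ (isPolicy_detPolicy π), sum_detPolicy_mul, Finset.mul_sum]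
      refine (Finset.abs_sum_le_sum_abs _ _).trans (Finset.sum_le_sum fun s' _ => ?_)
      rw [abs_mul, abs_of_nonneg (M.P_nonneg _ _ _)]
      have := mul_le_mul_of_nonneg_left (ih s') (M.P_nonneg s (π s) (some s'))
      linarith
  ext s
  have h0 := (hπ.survival_tendsto s).const_mul G
  rw [mul_zero] at h0
  exact abs_nonpos_iff.1 (ge_of_tendsto' h0 fun n => hle n s)

/-- The map `g ↦ g - P g` is injective because harmonic functions vanish, hence surjective in finite
dimension. -/
theorem IsProper.exists_potential (hπ : M.IsProper π) :
    ∃ v : S → ℝ, ∀ s, v s = 1 + ∑ s', M.P s (π s) (some s') * v s' := by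
  let L : (S → ℝ) →ₗ[ℝ] (S → ℝ) :=
    { toFun := fun g s => g s - ∑ s', M.P s (π s) (some s') * g s'
      map_add' := by
        intro f g; ext s
        simp only [Pi.add_apply, mul_add, Finset.sum_add_distrib]; ring
      map_smul' := by
        intro r g; ext s
        simp only [Pi.smul_apply, smul_eq_mul, RingHom.id_apply, mul_sub, Finset.mul_sum]
        congr 1
        exact Finset.sum_congr rfl fun s' _ => by ring }
  have hinj : Function.Injective L := by
    rw [← LinearMap.ker_eq_bot, LinearMap.ker_eq_bot']
    intro g hg
    refine hπ.eq_zero_of_harmonic fun s => ?_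
    have := congrFun hg s
    simp only [L, LinearMap.coe_mk, AddHom.coe_mk, Pi.zero_apply] at this
    linarith
  obtain ⟨v, hv⟩ := LinearMap.injective_iff_surjective.1 hinj 1
  refine ⟨v, fun s => ?_⟩
  have := congrFun hv s
  simp only [L, LinearMap.coe_mk, AddHom.coe_mk, Pi.one_apply] at this
  linarith

theorem trajCost_one (τ : Traj A) : trajCost (fun _ => 1) τ = τ.length := by
  simp [trajCost]

/-- Properness only says that episodes end almost surely; finiteness of the mean length is proved
here. The truncated mean is dominated inductively by the potential `v` plus `G` times survival,
where `G` absorbs a possibly negative `v` at `n = 0`. -/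
theorem IsProper.summable_length (hπ : M.IsProper π) (s : S) :
    Summable fun τ : Traj A => M.trajProb (detPolicy π) s τ * (τ.length : ℝ) := by
  have hp := isPolicy_detPolicy π
  obtain ⟨v, hv⟩ := hπ.exists_potential
  have hG : ∀ s, |v s| ≤ ∑ s', |v s'| := fun s =>
    Finset.single_le_sum (f := fun s' => |v s'|) (fun _ _ => abs_nonneg _) (Finset.mem_univ s)
  set G := ∑ s', |v s'|
  have hG0 : 0 ≤ G := (abs_nonneg _).trans (hG s)
  have hle : ∀ n s, M.truncExp (detPolicy π) (trajCost fun _ => 1) n s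
      ≤ v s + G * M.survival (detPolicy π) n s := by
    intro n
    induction n with
    | zero =>
      intro s
      rw [truncExp_zero, survival_zero]
      linarith [neg_abs_le (v s), hG s]
    | succ n ih =>
      intro s
      refine (M.truncExp_trajCost_succ_le hp (fun _ => zero_le_one) n s).trans ?_
      rw [M.survival_succ hp, sum_detPolicy_mul, sum_detPolicy_mul, hv s, Finset.mul_sum,
        add_assoc, ← Finset.sum_add_distrib]
      gcongr with s'
      have := mul_le_mul_of_nonneg_left (ih s') (M.P_nonneg s (π s) (some s'))
      linarith
  refine summable_of_sum_listsUpTo_le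
    (fun τ => mul_nonneg (M.trajProb_nonneg hp s τ) (Nat.cast_nonneg _)) (b := v s + G) ?_
  intro n
  have h1 := hle n s
  have h2 : M.survival (detPolicy π) n s ≤ 1 := by
    have := M.truncExp_nonneg hp (h := fun _ => 1) (fun _ => zero_le_one) n s
    unfold survival; linarith
  simp only [truncExp, trajCost_one] at h1
  nlinarith

theorem abs_trajCost_le {c : (Σ s, A s) → ℝ} {b : ℝ} (hb : ∀ x, |c x| ≤ b) (τ : Traj A) :
    |trajCost c τ| ≤ b * τ.length := by
  induction τ with
  | nil => simp [trajCost]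
  | cons x τ ih =>
    rw [trajCost_cons]
    push_cast [List.length_cons]
    calc _ ≤ |c x| + |trajCost c τ| := abs_add_le _ _
      _ ≤ _ := by linarith [hb x]

theorem IsProper.summable_cost (hπ : M.IsProper π) (c : (Σ s, A s) → ℝ) (s : S) :
    Summable fun τ : Traj A => M.trajProb (detPolicy π) s τ * trajCost c τ := by
  have hb : ∀ x, |c x| ≤ ∑ y, |c y| := fun x =>
    Finset.single_le_sum (f := fun y => |c y|) (fun _ _ => abs_nonneg _) (Finset.mem_univ x)
  refine Summable.of_norm_bounded ((hπ.summable_length s).mul_left (∑ y, |c y|)) fun τ => ?_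
  have h0 := M.trajProb_nonneg (isPolicy_detPolicy π) s τ
  rw [Real.norm_eq_abs, abs_mul, abs_of_nonneg h0]
  have := mul_le_mul_of_nonneg_left (abs_trajCost_le hb τ) h0
  linarith

theorem IsProper.costToGo_eq (hπ : M.IsProper π) (c : (Σ s, A s) → ℝ) (s : S) :
    M.costToGo c π s
      = c ⟨s, π s⟩ + ∑ s', M.P s (π s) (some s') * M.costToGo c π s' := by
  have hlim : ∀ s, Filter.Tendsto (fun n => M.truncExp (detPolicy π) (trajCost c) n s)
      Filter.atTop (nhds (M.costToGo c π s)) := fun s =>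
    (hπ.summable_cost c s).hasSum.comp (tendsto_listsUpTo _)
  have hone : ∀ s, Filter.Tendsto (fun n => M.truncExp (detPolicy π) (fun _ => 1) n s)
      Filter.atTop (nhds 1) := fun s => by
    have := (hπ s).comp (tendsto_listsUpTo _)
    simpa [truncExp, Function.comp_def] using this
  have h1 := (hlim s).comp (Filter.tendsto_add_atTop_nat 1)
  have h2 : Filter.Tendsto (fun n => M.P s (π s) none * c ⟨s, π s⟩
      + ∑ s', M.P s (π s) (some s') * (c ⟨s, π s⟩ * M.truncExp (detPolicy π) (fun _ => 1) n s'
        + M.truncExp (detPolicy π) (trajCost c) n s')) Filter.atTop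
      (nhds (M.P s (π s) none * c ⟨s, π s⟩
        + ∑ s', M.P s (π s) (some s') * (c ⟨s, π s⟩ * 1 + M.costToGo c π s'))) :=
    tendsto_const_nhds.add (tendsto_finsetSum _ fun s' _ =>
      (((hone s').const_mul _).add (hlim s')).const_mul _)
  have h3 := tendsto_nhds_unique h1 (h2.congr fun n => by
    rw [Function.comp_apply, truncExp_trajCost_succ, sum_detPolicy_mul])
  rw [h3, P_none_eq]
  simp only [mul_one, mul_add, Finset.sum_add_distrib, ← Finset.sum_mul]
  ring

theorem hittingTime_eq_costToGo (π : (s : S) → A s) (s : S) :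
    M.hittingTime π s = M.costToGo (fun _ => 1) π s := by
  simp [hittingTime, costToGo, trajCost_one]

theorem costToGo_nonneg {c : (Σ s, A s) → ℝ} (hc : ∀ x, 0 ≤ c x) (π : (s : S) → A s) (s : S) :
    0 ≤ M.costToGo c π s :=
  tsum_nonneg fun τ => mul_nonneg (M.trajProb_nonneg (isPolicy_detPolicy π) s τ)
    (trajCost_nonneg hc τ)

theorem IsProper.one_le_hittingTime (hπ : M.IsProper π) (s : S) : 1 ≤ M.hittingTime π s := by
  rw [hittingTime_eq_costToGo, hπ.costToGo_eq]
  have : 0 ≤ ∑ s', M.P s (π s) (some s') * M.costToGo (fun _ => 1) π s' :=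
    Finset.sum_nonneg fun s' _ => mul_nonneg (M.P_nonneg _ _ _)
      (costToGo_nonneg (fun _ => zero_le_one) π s')
  linarith

theorem IsProper.costToGo_le_hittingTime (hπ : M.IsProper π) {c : (Σ s, A s) → ℝ}
    (hc : ∀ x, c x ∈ Set.Icc (0 : ℝ) 1) (s : S) : M.costToGo c π s ≤ M.hittingTime π s := by
  refine (hπ.summable_cost c s).tsum_le_tsum (fun τ => ?_) (hπ.summable_length s)
  refine mul_le_mul_of_nonneg_left ?_ (M.trajProb_nonneg (isPolicy_detPolicy π) s τ)
  have := abs_trajCost_le (b := 1) (c := c)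
    (fun x => abs_le.2 ⟨by linarith [(hc x).1], (hc x).2⟩) τ
  linarith [le_abs_self (trajCost c τ)]

theorem IsProper.costToGo_sub (hπ : M.IsProper π) (c d : (Σ s, A s) → ℝ) (s : S) :
    M.costToGo (fun x => c x - d x) π s = M.costToGo c π s - M.costToGo d π s := by
  unfold costToGo
  rw [← (hπ.summable_cost c s).tsum_sub (hπ.summable_cost d s)]
  refine tsum_congr fun τ => ?_
  rw [← mul_sub]
  congr 1
  induction τ with
  | nil => simp [trajCost]
  | cons x τ ih => simp only [trajCost_cons, ih]; ring

open Classical in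
/-- The occupancy measure of a deterministic policy. -/
def detOccupancy (M : SSP S A) (π : (s : S) → A s) (x : Σ s, A s) : ℝ :=
  M.costToGo (fun y => if y = x then 1 else 0) π M.init

theorem IsProper.sum_detOccupancy_mul (hπ : M.IsProper π) (c : (Σ s, A s) → ℝ) :
    ∑ x, M.detOccupancy π x * c x = M.costToGo c π M.init := by
  classical
  have h1 : ∀ x, HasSum (fun τ => M.trajProb (detPolicy π) M.init τ
      * trajCost (fun y => if y = x then 1 else 0) τ * c x) (M.detOccupancy π x * c x) := by
    intro x
    have := ((hπ.summable_cost (fun y => if y = x then 1 else 0) M.init).hasSum).mul_right (c x)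
    exact this
  have h2 := hasSum_sum fun x (_ : x ∈ Finset.univ) => h1 x
  rw [← h2.tsum_eq]
  refine tsum_congr fun τ => ?_
  simp only [mul_assoc, ← Finset.mul_sum]
  congr 1
  induction τ with
  | nil => simp [trajCost]
  | cons x τ ih =>
    simp only [trajCost_cons, add_mul, Finset.sum_add_distrib, ih]
    simp

/-- The cost `f - P f` telescopes. -/
theorem IsProper.costToGo_sub_transition (hπ : M.IsProper π) (f : S → ℝ) (s : S) :
    M.costToGo (fun x => f x.1 - ∑ s', M.P x.1 x.2 (some s') * f s') π s = f s := by
  set c : (Σ s, A s) → ℝ := fun x => f x.1 - ∑ s', M.P x.1 x.2 (some s') * f s' with hc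
  have h0 : (fun s => M.costToGo c π s - f s) = 0 := by
    refine hπ.eq_zero_of_harmonic fun s => ?_
    rw [hπ.costToGo_eq c s, hc]
    simp only [mul_sub, Finset.sum_sub_distrib]
    ring
  have := congrFun h0 s
  simp only [Pi.zero_apply] at this
  linarith

theorem IsProper.detOccupancy_mem (hπ : M.IsProper π) {T : ℝ}
    (hT : M.hittingTime π M.init ≤ T) : M.detOccupancy π ∈ M.occupancySet T := by
  classical
  refine ⟨fun x => costToGo_nonneg (fun y => by split_ifs <;> norm_num) π _, ?_, fun s => ?_⟩
  · have := hπ.sum_detOccupancy_mul fun _ => 1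
    rw [← hittingTime_eq_costToGo] at this
    simp only [mul_one] at this
    linarith
  -- The flow constraint at `s` is the telescoping identity for the indicator of `s`.
  · have h1 := hπ.costToGo_sub_transition (fun s' => if s' = s then 1 else 0) M.init
    rw [hπ.costToGo_sub, ← hπ.sum_detOccupancy_mul, ← hπ.sum_detOccupancy_mul] at h1
    simp only [eq_comm (a := s)]
    rw [← h1]
    congr 1
    · rw [Fintype.sum_sigma, Finset.sum_eq_single s]
      · simp
      · intro s' _ hs'; simp [hs']
      · simp
    · refine Finset.sum_congr rfl fun x _ => ?_
      simp [mul_comm]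

end Proper

end Trajectories

/-! ### Pathwise regret of the workers and of the meta algorithm -/

section Algorithm

variable {S : Type*} {A : S → Type*} [Fintype S] [DecidableEq S] [∀ s, Fintype (A s)]
  {M : SSP S A}

/-! ### The fast policy and the diameter -/

theorem fastTime_le {π : (s : S) → A s} (hπ : M.IsProper π) (s : S) :
    M.fastTime s ≤ M.hittingTime π s :=
  ciInf_le (Finite.bddBelow_range fun π : {π : (s : S) → A s // M.IsProper π} =>
    M.hittingTime π.1 s) ⟨π, hπ⟩

theorem exists_fastPolicy (hM : ∃ π, M.IsProper π) (s : S) :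
    ∃ π, M.IsProper π ∧ M.hittingTime π s = M.fastTime s := by
  have : Nonempty {π : (s : S) → A s // M.IsProper π} := hM.elim fun π hπ => ⟨⟨π, hπ⟩⟩
  obtain ⟨π, hπ⟩ := exists_eq_ciInf_of_finite
    (f := fun π : {π : (s : S) → A s // M.IsProper π} => M.hittingTime π.1 s)
  exact ⟨π.1, π.2, hπ⟩

theorem one_le_fastTime (hM : ∃ π, M.IsProper π) (s : S) : 1 ≤ M.fastTime s := by
  obtain ⟨π, hπ, h⟩ := exists_fastPolicy hM s
  exact h ▸ hπ.one_le_hittingTime s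

theorem fastTime_le_diameter (s : S) : M.fastTime s ≤ M.diameter :=
  le_ciSup (Finite.bddAbove_range M.fastTime) s

theorem one_le_diameter (hM : ∃ π, M.IsProper π) : 1 ≤ M.diameter :=
  (one_le_fastTime hM M.init).trans (fastTime_le_diameter M.init)

theorem nonempty_occupancySet (hM : ∃ π, M.IsProper π) {T : ℝ} (hT : M.fastTime M.init ≤ T) :
    (M.occupancySet T).Nonempty := by
  obtain ⟨π, hπ, h⟩ := exists_fastPolicy hM M.init
  exact ⟨_, hπ.detOccupancy_mem (h.trans_le hT)⟩

theorem convex_occupancySet (T : ℝ) : Convex ℝ (M.occupancySet T) := by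
  rintro p ⟨hp0, hpT, hp⟩ q ⟨hq0, hqT, hq⟩ a b ha hb hab
  refine ⟨fun x => ?_, ?_, fun s => ?_⟩
  · exact add_nonneg (mul_nonneg ha (hp0 x)) (mul_nonneg hb (hq0 x))
  · simp only [Pi.add_apply, Pi.smul_apply, smul_eq_mul, Finset.sum_add_distrib,
      ← Finset.mul_sum]
    calc _ ≤ a * T + b * T := by gcongr
      _ = T := by rw [← add_mul, hab, one_mul]
  · have h1 := hp s
    have h2 := hq s
    simp only [Pi.add_apply, Pi.smul_apply, smul_eq_mul, mul_add, Finset.sum_add_distrib,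
      mul_left_comm _ a, mul_left_comm _ b, ← Finset.mul_sum]
    calc _ = a * (∑ a, p ⟨s, a⟩ - ∑ x : Σ s, A s, M.P x.1 x.2 (some s) * p x)
          + b * (∑ a, q ⟨s, a⟩ - ∑ x : Σ s, A s, M.P x.1 x.2 (some s) * q x) := by ring
      _ = _ := by rw [h1, h2, ← add_mul, hab, one_mul]

theorem isCompact_occupancySet (T : ℝ) : IsCompact (M.occupancySet T) := by
  refine (isCompact_Icc (a := (0 : (Σ s, A s) → ℝ)) (b := fun _ => T)).of_isClosed_subset ?_ ?_
  · have h : M.occupancySet T = (⋂ x, {q | 0 ≤ q x}) ∩ ({q | ∑ x, q x ≤ T} ∩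
        ⋂ s, {q | ∑ a, q ⟨s, a⟩ - ∑ x : Σ s, A s, M.P x.1 x.2 (some s) * q x
          = if s = M.init then 1 else 0}) := by
      ext q; simp [occupancySet]
    rw [h]
    refine (isClosed_iInter fun x => isClosed_le (by fun_prop) (by fun_prop)).inter
      ((isClosed_le (by fun_prop) (by fun_prop)).inter
        (isClosed_iInter fun s => isClosed_eq (by fun_prop) (by fun_prop)))
  · intro q hq
    exact ⟨hq.1, fun x =>
      (Finset.single_le_sum (fun y _ => hq.1 y) (Finset.mem_univ x)).trans hq.2.1⟩

theorem one_le_sum_of_mem {T : ℝ} {q : (Σ s, A s) → ℝ} (hq : q ∈ M.occupancySet T) :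
    1 ≤ ∑ x, q x := by
  have h1 := hq.2.2 M.init
  rw [if_pos rfl] at h1
  have h2 : 0 ≤ ∑ x : Σ s, A s, M.P x.1 x.2 (some M.init) * q x :=
    Finset.sum_nonneg fun x _ => mul_nonneg (M.P_nonneg _ _ _) (hq.1 x)
  rw [Fintype.sum_sigma]
  have h3 := Finset.single_le_sum (f := fun s => ∑ a, q ⟨s, a⟩)
    (fun s _ => Finset.sum_nonneg fun a _ => hq.1 ⟨s, a⟩) (Finset.mem_univ M.init)
  linarith

theorem sum_mul_cost_le {T : ℝ} {q c : (Σ s, A s) → ℝ} (hq : q ∈ M.occupancySet T)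
    (hc : ∀ x, c x ∈ Set.Icc (0 : ℝ) 1) : ∑ x, q x * c x ≤ T :=
  (Finset.sum_le_sum fun x _ => mul_le_of_le_one_right (hq.1 x) (hc x).2).trans hq.2.1

theorem sum_mul_cost_nonneg {T : ℝ} {q c : (Σ s, A s) → ℝ} (hq : q ∈ M.occupancySet T)
    (hc : ∀ x, c x ∈ Set.Icc (0 : ℝ) 1) : 0 ≤ ∑ x, q x * c x :=
  Finset.sum_nonneg fun x _ => mul_nonneg (hq.1 x) (hc x).1

/-- All cost functions in the list take values in `[0, 1]`. -/
def UnitCosts (cs : List ((Σ s, A s) → ℝ)) : Prop := ∀ c ∈ cs, ∀ x, c x ∈ Set.Icc (0 : ℝ) 1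

/-! ### A single worker -/

theorem worker_spec (hM : ∃ π, M.IsProper π) (K : ℕ) {T : ℝ} (hT : M.fastTime M.init ≤ T)
    (c : (Σ s, A s) → ℝ) (cs : List ((Σ s, A s) → ℝ)) :
    M.worker K T (c :: cs) ∈ M.occupancySet T ∧ IsMinOn (fun q =>
      ∑ x, q x * c x + bregman (fun _ => M.workerRate K T) q (M.worker K T cs))
      (M.occupancySet T) (M.worker K T (c :: cs)) :=
  argminOn_spec (isCompact_occupancySet T) (nonempty_occupancySet hM hT)
    (continuous_linear_add_bregman _ _ _)

/-- The zero linear term casts the initial iterate in the form used by the support and first-order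
lemmas. -/
theorem worker_nil_spec (hM : ∃ π, M.IsProper π) (K : ℕ) {T : ℝ}
    (hT : M.fastTime M.init ≤ T) :
    M.worker K T [] ∈ M.occupancySet T ∧ IsMinOn (fun q : (Σ s, A s) → ℝ =>
      ∑ x, q x * (0 : (Σ s, A s) → ℝ) x + negEntropy (fun _ => M.workerRate K T) q)
      (M.occupancySet T) (M.worker K T []) := by
  have := argminOn_spec (isCompact_occupancySet (M := M) T) (nonempty_occupancySet hM hT)
    (continuous_negEntropy fun _ => M.workerRate K T)
  refine ⟨this.1, ?_⟩
  simp only [Pi.zero_apply, mul_zero, Finset.sum_const_zero, zero_add]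
  exact this.2

theorem worker_mem (hM : ∃ π, M.IsProper π) (K : ℕ) {T : ℝ} (hT : M.fastTime M.init ≤ T)
    (cs : List ((Σ s, A s) → ℝ)) : M.worker K T cs ∈ M.occupancySet T := by
  cases cs with
  | nil => exact (worker_nil_spec hM K hT).1
  | cons c cs => exact (worker_spec hM K hT c cs).1

theorem worker_support (hM : ∃ π, M.IsProper π) {K : ℕ} {T : ℝ} (hT : M.fastTime M.init ≤ T)
    (hη : 0 < M.workerRate K T) (cs : List ((Σ s, A s) → ℝ)) :
    ∀ u ∈ M.occupancySet T, ∀ x, M.worker K T cs x = 0 → u x = 0 := by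
  intro u hu x
  cases cs with
  | nil =>
    exact support_of_isMinOn (convex_occupancySet T) (fun q hq => hq.1) (fun _ => hη)
      (worker_nil_spec hM K hT).1 (worker_nil_spec hM K hT).2 hu x
  | cons c cs =>
    exact support_of_isMinOn (convex_occupancySet T) (fun q hq => hq.1) (fun _ => hη)
      (worker_spec hM K hT c cs).1 (isMinOn_of_linear_add_bregman (worker_spec hM K hT c cs).2)
      hu x

/-- The total loss of a worker along a list of cost functions, the most recent one first. -/
def cumWorkerLoss (M : SSP S A) (K : ℕ) (T : ℝ) : List ((Σ s, A s) → ℝ) → ℝ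
  | [] => 0
  | c :: cs => ∑ x, M.worker K T cs x * c x + cumWorkerLoss M K T cs

theorem cumWorkerLoss_nonneg (hM : ∃ π, M.IsProper π) (K : ℕ) {T : ℝ}
    (hT : M.fastTime M.init ≤ T) {cs : List ((Σ s, A s) → ℝ)} (hcs : UnitCosts cs) :
    0 ≤ M.cumWorkerLoss K T cs := by
  induction cs with
  | nil => exact le_rfl
  | cons c cs ih =>
    exact add_nonneg (sum_mul_cost_nonneg (worker_mem hM K hT cs) (hcs c (by simp)))
      (ih fun d hd => hcs d (by simp [hd]))

/-- The mirror descent steps telescope. Because `c² ≤ c`, the stability terms add up to the worker's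
own loss, not to the cruder `T K`; this is the source of a bound of order `√(D T K)`. -/
theorem cumWorkerLoss_sub_le_bregman (hM : ∃ π, M.IsProper π) {K : ℕ} {T : ℝ}
    (hT : M.fastTime M.init ≤ T) (hη : 0 < M.workerRate K T) {u : (Σ s, A s) → ℝ}
    (hu : u ∈ M.occupancySet T) {cs : List ((Σ s, A s) → ℝ)} (hcs : UnitCosts cs) :
    M.cumWorkerLoss K T cs - (cs.map fun c => ∑ x, u x * c x).sum
      ≤ bregman (fun _ => M.workerRate K T) u (M.worker K T [])
        - bregman (fun _ => M.workerRate K T) u (M.worker K T cs)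
        + M.workerRate K T / 2 * M.cumWorkerLoss K T cs := by
  induction cs with
  | nil => simp [cumWorkerLoss]
  | cons c cs ih =>
    have hc := hcs c (by simp)
    have ih := ih fun d hd => hcs d (by simp [hd])
    have hw := worker_mem hM K hT cs
    have hstep := mirror_descent_step (convex_occupancySet T) (fun q hq => hq.1)
      (fun _ => hη) (fun x => (hc x).1) hw.1 (worker_support hM hT hη cs)
      (worker_spec hM K hT c cs).1 (worker_spec hM K hT c cs).2 hu
    have hsq : ∑ x, M.workerRate K T / 2 * (M.worker K T cs x * c x ^ 2)
        ≤ M.workerRate K T / 2 * ∑ x, M.worker K T cs x * c x := by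
      rw [← Finset.mul_sum]
      refine mul_le_mul_of_nonneg_left (Finset.sum_le_sum fun x _ => ?_) (by linarith)
      refine mul_le_mul_of_nonneg_left ?_ (hw.1 x)
      nlinarith [(hc x).1, (hc x).2]
    simp only [cumWorkerLoss, List.map_cons, List.sum_cons, mul_add]
    linarith

theorem sum_mul_log_le {ι : Type*} [Fintype ι] {u : ι → ℝ} (hu : ∀ i, 0 ≤ u i) {T : ℝ}
    (hT : 1 ≤ T) (hs : ∑ i, u i ≤ T) : ∑ i, u i * Real.log (u i) ≤ T * Real.log T := by
  have hlog : 0 ≤ Real.log T := Real.log_nonneg hT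
  calc _ ≤ ∑ i, u i * Real.log T := by
        refine Finset.sum_le_sum fun i _ => ?_
        rcases (hu i).eq_or_lt with h | h
        · simp [← h]
        · refine mul_le_mul_of_nonneg_left (Real.log_le_log h ?_) h.le
          exact (Finset.single_le_sum (fun j _ => hu j) (Finset.mem_univ i)).trans hs
    _ ≤ _ := by rw [← Finset.sum_mul]; gcongr

/-- Tangent inequality at the uniform vector of the same mass `m`; the term `m log m` is nonnegative
since `m ≥ 1`. -/
theorem neg_sum_mul_log_le {ι : Type*} [Fintype ι] {z : ι → ℝ} (hz : ∀ i, 0 ≤ z i) {T : ℝ}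
    (h1 : 1 ≤ ∑ i, z i) (hs : ∑ i, z i ≤ T) :
    -(∑ i, z i * Real.log (z i)) ≤ T * Real.log (Fintype.card ι) := by
  set m := ∑ i, z i with hm
  have : Nonempty ι := by
    by_contra h
    rw [not_nonempty_iff] at h
    simp [m] at h1
    linarith
  have hn : (1 : ℝ) ≤ Fintype.card ι := by exact_mod_cast Fintype.card_pos
  have hlog := Real.log_nonneg hn
  have hpos : 0 < m / Fintype.card ι := by positivity
  have key := Finset.sum_le_sum fun i (_ : i ∈ Finset.univ) =>
    mul_log_le_mul_log_add (hz i) hpos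
  rw [← Finset.sum_mul, Finset.sum_sub_distrib, Finset.sum_add_distrib, Finset.sum_const,
    Finset.card_univ, nsmul_eq_mul, mul_div_cancel₀ _ (by positivity), ← hm,
    Real.log_div (by positivity) (by positivity)] at key
  have h3 : 0 ≤ m * Real.log m := mul_nonneg (by linarith) (Real.log_nonneg h1)
  have h4 := mul_le_mul_of_nonneg_right hs hlog
  nlinarith

theorem card_pos_of_model (hM : ∃ π, M.IsProper π) : 0 < Fintype.card (Σ s, A s) := by
  obtain ⟨π, _⟩ := hM
  exact Fintype.card_pos_iff.2 ⟨⟨M.init, π M.init⟩⟩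

theorem bregman_worker_nil_le (hM : ∃ π, M.IsProper π) {K : ℕ} {T : ℝ}
    (hT : M.fastTime M.init ≤ T) (hη : 0 < M.workerRate K T) {u : (Σ s, A s) → ℝ}
    (hu : u ∈ M.occupancySet T) :
    bregman (fun _ => M.workerRate K T) u (M.worker K T [])
      ≤ T * Real.log (Fintype.card (Σ s, A s) * T) / M.workerRate K T := by
  obtain ⟨hz, hmin⟩ := worker_nil_spec hM K hT
  -- Optimality of the initial iterate discards the gradient term of the divergence, so only a
  -- difference of entropies remains.
  have h1 := first_order_of_isMinOn (convex_occupancySet T) (fun q hq => hq.1) (fun _ => hη)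
    hz hmin hu
  simp only [Pi.zero_apply, zero_add] at h1
  have hT1 : 1 ≤ T := (one_le_fastTime hM _).trans hT
  have h2 := sum_mul_log_le hu.1 hT1 hu.2.1
  have h3 := neg_sum_mul_log_le hz.1 (one_le_sum_of_mem hz) hz.2.1
  have hcard : (0 : ℝ) < Fintype.card (Σ s, A s) := by exact_mod_cast card_pos_of_model hM
  rw [Real.log_mul hcard.ne' (by linarith)]
  unfold bregman negEntropy
  rw [← Finset.mul_sum, ← Finset.mul_sum]
  beta_reduce
  have h4 : 1 / M.workerRate K T * (∑ x, u x * Real.log (u x)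
      - ∑ x, M.worker K T [] x * Real.log (M.worker K T [] x))
      ≤ 1 / M.workerRate K T * (T * (Real.log (Fintype.card (Σ s, A s)) + Real.log T)) :=
    mul_le_mul_of_nonneg_left (by linarith) (one_div_nonneg.2 hη.le)
  have h5 : T * (Real.log (Fintype.card (Σ s, A s)) + Real.log T) / M.workerRate K T
      = 1 / M.workerRate K T * (T * (Real.log (Fintype.card (Σ s, A s)) + Real.log T)) := by
    ring
  rw [h5]
  linarith

/-- The choice of the learning rate of a worker. -/
theorem tuned_rate_bound {s U T L η X Λ : ℝ} (hη : 0 < η) (hηd : η = min (1 / 2) √(T * L / X))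
    (hs0 : 0 ≤ s) (h : s - U ≤ T * L / η + η / 2 * s) (hU : U ≤ X) (hX : 0 < X) (hT : 0 < T)
    (hTX : T ≤ 2 * X) (hL0 : 0 ≤ L) (hL : L ≤ Λ) (hΛ : 1 ≤ Λ) :
    s - U ≤ 12 * Λ * √(T * X) := by
  have hη2 : η ≤ 1 / 2 := hηd ▸ min_le_left _ _
  set r := √(T * X) with hr
  have hr0 : 0 ≤ r := Real.sqrt_nonneg _
  have hrsq : r ^ 2 = T * X := Real.sq_sqrt (by positivity)
  set E := T * L / η with hE
  have hE0 : 0 ≤ E := by positivity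
  -- Since `η ≤ 1/2`, the self-bounding term is at most `s/4` and can be absorbed.
  have hS : s * (3 / 4) ≤ X + E := by nlinarith
  have hmain : s - U ≤ 2 * (E + η * X) := by nlinarith [mul_nonneg hη.le hE0, mul_pos hη hX]
  have hTr : T ≤ 3 / 2 * r := by
    refine le_of_sq_le_sq ?_ (by positivity)
    nlinarith
  rcases le_total (√(T * L / X)) (1 / 2) with hc | hc
  · rw [min_eq_right hc] at hηd
    have hsq : η ^ 2 = T * L / X := by rw [hηd]; exact Real.sq_sqrt (by positivity)
    have hTL : T * L = η ^ 2 * X := by rw [hsq]; field_simp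
    have hEX : E = η * X := by rw [hE, hTL]; field_simp
    have hle : η * X ≤ Λ * r := by
      refine le_of_sq_le_sq ?_ (by positivity)
      have h1 : (η * X) ^ 2 = L * r ^ 2 := by rw [hrsq, mul_pow]; nlinarith
      rw [h1, mul_pow]
      exact mul_le_mul_of_nonneg_right (by nlinarith) (sq_nonneg r)
    have : 0 ≤ Λ * r := by positivity
    linarith
  · rw [min_eq_left hc] at hηd
    -- With the rate clipped at `1/2` the regret is at most `4 T L + X ≤ 8 T L`, and `T ≤ 3/2 r`
    -- produces the constant 12.
    have hX4 : X ≤ 4 * (T * L) := by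
      have h1 : (1 / 2 : ℝ) ^ 2 ≤ T * L / X := by
        rw [← Real.sq_sqrt (show 0 ≤ T * L / X by positivity)]
        exact pow_le_pow_left₀ (by norm_num) hc 2
      rw [le_div_iff₀ hX] at h1
      linarith
    have hE2 : E = 2 * (T * L) := by rw [hE, hηd]; ring
    have h2 : T * L ≤ 3 / 2 * r * Λ := mul_le_mul hTr hL hL0 (by positivity)
    rw [hE2, hηd] at hmain
    linarith

theorem cumWorkerLoss_sub_le (hM : ∃ π, M.IsProper π) {K : ℕ} (hK : 1 ≤ K) {T Λ : ℝ}
    (hT : M.fastTime M.init ≤ T) (hTX : T ≤ 2 * (M.diameter * K))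
    (hL : Real.log (Fintype.card (Σ s, A s) * T) ≤ Λ) (hΛ : 1 ≤ Λ) {u : (Σ s, A s) → ℝ}
    (hu : u ∈ M.occupancySet T) {cs : List ((Σ s, A s) → ℝ)} (hcs : UnitCosts cs)
    (hU : (cs.map fun c => ∑ x, u x * c x).sum ≤ M.diameter * K) :
    M.cumWorkerLoss K T cs - (cs.map fun c => ∑ x, u x * c x).sum
      ≤ 12 * Λ * √(T * (M.diameter * K)) := by
  have hT1 : 1 ≤ T := (one_le_fastTime hM _).trans hT
  have hD := one_le_diameter hM
  have hK' : (1 : ℝ) ≤ K := by exact_mod_cast hK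
  have hcard : (1 : ℝ) ≤ Fintype.card (Σ s, A s) := by exact_mod_cast card_pos_of_model hM
  have hX : 0 < M.diameter * K := by positivity
  rcases (show 1 ≤ Fintype.card (Σ s, A s) * T by nlinarith).eq_or_lt with h1 | h1
  -- Degenerate case: the logarithm and hence the rate are zero, so the mirror descent analysis does
  -- not apply. But then `SA = T = 1`, `Δ(T)` has at most one point, and worker and comparator
  -- coincide.
  · have hc1 : (Fintype.card (Σ s, A s) : ℝ) = 1 := by nlinarith
    have hT2 : T = 1 := by nlinarith
    have hc2 : Fintype.card (Σ s, A s) = 1 := by exact_mod_cast hc1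
    have : Subsingleton (Σ s, A s) := Fintype.card_le_one_iff_subsingleton.1 hc2.le
    have huniq : ∀ q ∈ M.occupancySet T, ∀ x, q x = 1 := by
      intro q hq x
      have h2 := one_le_sum_of_mem hq
      have h3 := hq.2.1
      rw [Fintype.sum_subsingleton _ x] at h2 h3
      linarith
    have heq : M.cumWorkerLoss K T cs = (cs.map fun c => ∑ x, u x * c x).sum := by
      clear hU hcs
      induction cs with
      | nil => rfl
      | cons c cs ih =>
        simp only [cumWorkerLoss, List.map_cons, List.sum_cons, ih, huniq u hu,
          huniq _ (worker_mem hM K hT cs)]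
    rw [heq, sub_self]
    positivity
  · have hL0 := Real.log_pos h1
    have hη : 0 < M.workerRate K T := by
      unfold workerRate
      have : 0 < T := by linarith
      exact lt_min (by norm_num) (Real.sqrt_pos.2 (by positivity))
    have hb := cumWorkerLoss_sub_le_bregman hM hT hη hu hcs
    have hb0 := bregman_nonneg (fun _ => hη) hu.1 (worker_mem hM K hT cs).1
      (worker_support hM hT hη cs u hu)
    have hb1 := bregman_worker_nil_le hM hT hη hu
    exact tuned_rate_bound hη rfl (cumWorkerLoss_nonneg hM K hT hcs) (by linarith) hU hX
      (by linarith) hTX hL0.le hL hΛ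

/-! ### The grid -/

theorem le_two_pow_ceil_logb {x : ℝ} (hx : 1 ≤ x) : x ≤ 2 ^ ⌈Real.logb 2 x⌉₊ := by
  have h := Nat.le_ceil (Real.logb 2 x)
  rw [Real.logb_le_iff_le_rpow (by norm_num) (by linarith), Real.rpow_natCast] at h
  exact h

theorem two_pow_ceil_logb_le {x : ℝ} (hx : 1 ≤ x) : (2 : ℝ) ^ ⌈Real.logb 2 x⌉₊ ≤ 2 * x := by
  have h := Nat.ceil_lt_add_one (Real.logb_nonneg (by norm_num : (1 : ℝ) < 2) hx)
  have h2 : (2 : ℝ) ^ (⌈Real.logb 2 x⌉₊ : ℝ) ≤ 2 ^ (Real.logb 2 x + 1) :=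
    Real.rpow_le_rpow_of_exponent_le (by norm_num) h.le
  rw [Real.rpow_natCast, Real.rpow_add (by norm_num), Real.rpow_logb (by norm_num) (by norm_num)
    (by linarith), Real.rpow_one] at h2
  linarith

theorem grid_pos (j : ℕ) : 0 < M.grid j := by unfold grid; positivity

theorem fastTime_le_grid (hM : ∃ π, M.IsProper π) (j : ℕ) : M.fastTime M.init ≤ M.grid j :=
  (le_two_pow_ceil_logb (one_le_fastTime hM _)).trans
    (pow_le_pow_right₀ (by norm_num) (Nat.le_add_right _ _))

theorem grid_le {B : ℝ} (hB : 1 ≤ B) {j : ℕ} (hj : j < M.gridSize B) : M.grid j ≤ 2 * B := by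
  refine le_trans ?_ (two_pow_ceil_logb_le hB)
  unfold grid
  unfold gridSize at hj
  exact pow_le_pow_right₀ (by norm_num) (by omega)

theorem exists_grid (hM : ∃ π, M.IsProper π) {B T : ℝ} (hT : M.fastTime M.init ≤ T)
    (hTB : T ≤ B) : ∃ j : Fin (M.gridSize B), T ≤ M.grid j ∧ M.grid j ≤ 2 * T := by
  have h1 := one_le_fastTime hM M.init
  have hm : M.gridBase ≤ ⌈Real.logb 2 T⌉₊ :=
    Nat.ceil_mono (Real.logb_le_logb_of_le (by norm_num) (by linarith) hT)
  have hm2 : ⌈Real.logb 2 T⌉₊ ≤ ⌈Real.logb 2 B⌉₊ :=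
    Nat.ceil_mono (Real.logb_le_logb_of_le (by norm_num) (by linarith) hTB)
  refine ⟨⟨⌈Real.logb 2 T⌉₊ - M.gridBase, by unfold gridSize; omega⟩, ?_⟩
  simp only [grid, Nat.add_sub_cancel' hm]
  exact ⟨le_two_pow_ceil_logb (by linarith), two_pow_ceil_logb_le (by linarith)⟩

theorem gridSize_le {B : ℝ} (hB : 1 ≤ B) : (M.gridSize B : ℝ) ≤ 2 * (1 + Real.log B) := by
  have h1 : (M.gridSize B : ℝ) ≤ ⌈Real.logb 2 B⌉₊ + 1 := by
    unfold gridSize; exact_mod_cast Nat.sub_le _ _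
  have h2 := Nat.ceil_lt_add_one (Real.logb_nonneg (by norm_num : (1 : ℝ) < 2) hB)
  have h3 : Real.logb 2 B ≤ 2 * Real.log B := by
    have hl := Real.log_two_gt_d9
    rw [Real.logb, div_le_iff₀ (by linarith)]
    nlinarith [Real.log_nonneg hB]
  linarith

/-! ### The meta algorithm -/

theorem metaRate_pos (hM : ∃ π, M.IsProper π) {K : ℕ} (hK : 1 ≤ K) (j : ℕ) :
    0 < M.metaRate K j := by
  have hD := one_le_diameter hM
  have hK' : (1 : ℝ) ≤ K := by exact_mod_cast hK
  have := M.grid_pos j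
  unfold metaRate
  positivity

theorem metaRate_anti (hM : ∃ π, M.IsProper π) {K : ℕ} (hK : 1 ≤ K) (j : ℕ) :
    M.metaRate K j ≤ M.metaRate K 0 := by
  have hD := one_le_diameter hM
  have hK' : (1 : ℝ) ≤ K := by exact_mod_cast hK
  have := M.grid_pos 0
  unfold metaRate
  refine one_div_le_one_div_of_le (Real.sqrt_pos.2 (by positivity)) (Real.sqrt_le_sqrt ?_)
  refine mul_le_mul_of_nonneg_left ?_ (by positivity)
  exact pow_le_pow_right₀ (by norm_num) (by omega)

/-- The exact ratio is `2 ^ (j / 2)`; the cruder factor suffices because only its logarithm is used.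
-/
theorem metaRate_zero_le (hM : ∃ π, M.IsProper π) {K : ℕ} (hK : 1 ≤ K) (j : ℕ) :
    M.metaRate K 0 ≤ 2 ^ j * M.metaRate K j := by
  have hD := one_le_diameter hM
  have hK' : (1 : ℝ) ≤ K := by exact_mod_cast hK
  have h0 := M.grid_pos 0
  have hg : M.grid j = 2 ^ j * M.grid 0 := by unfold grid; rw [pow_add, pow_add]; ring
  have hX : 0 < √(32 * M.diameter * K * M.grid 0) := Real.sqrt_pos.2 (by positivity)
  have h2 : √(32 * M.diameter * K * M.grid j)
      ≤ 2 ^ j * √(32 * M.diameter * K * M.grid 0) := by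
    refine Real.sqrt_le_iff.2 ⟨by positivity, ?_⟩
    rw [mul_pow, Real.sq_sqrt (by positivity), hg]
    have h1 : (1 : ℝ) ≤ 2 ^ j := one_le_pow₀ (by norm_num)
    have : (2 : ℝ) ^ j ≤ (2 ^ j) ^ 2 := by nlinarith
    calc _ = 2 ^ j * (32 * M.diameter * K * M.grid 0) := by ring
      _ ≤ _ := mul_le_mul_of_nonneg_right this (by positivity)
  have hXj : 0 < √(32 * M.diameter * K * M.grid j) :=
    Real.sqrt_pos.2 (by have := M.grid_pos j; positivity)
  unfold metaRate
  rw [mul_one_div, div_le_div_iff₀ hX hXj]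
  linarith

/-- Rates are largest at index 0, so all `N` shares are at most `1/N` and the mass left to index 0
is at least its own share. -/
theorem metaInit_ge (hM : ∃ π, M.IsProper π) {K N : ℕ} (hK : 1 ≤ K) (j : Fin N) :
    M.metaRate K j / (N * M.metaRate K 0) ≤ M.metaInit K N j := by
  unfold metaInit
  split_ifs with h
  · have hη := metaRate_pos hM hK (M := M)
    have hN : (0 : ℝ) < N := by exact_mod_cast j.pos
    have hsum : ∑ i : Fin N, M.metaRate K i / (N * M.metaRate K 0) ≤ 1 := by
      calc _ ≤ ∑ i : Fin N, 1 / (N : ℝ) := by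
            refine Finset.sum_le_sum fun i _ => ?_
            rw [div_le_div_iff₀ (mul_pos hN (hη 0)) hN]
            nlinarith [metaRate_anti hM hK (M := M) i]
        _ = 1 := by simp [hN.ne']
    have hle : ∑ i : Fin N, (if i.1 = 0 then 0 else M.metaRate K i / (N * M.metaRate K 0))
        = ∑ i : Fin N, M.metaRate K i / (N * M.metaRate K 0)
          - M.metaRate K j / (N * M.metaRate K 0) := by
      rw [eq_sub_iff_add_eq, ← Finset.sum_erase_add _ _ (Finset.mem_univ j),
        ← Finset.sum_erase_add _ _ (Finset.mem_univ j), if_pos h, add_zero]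
      congr 1
      refine Finset.sum_congr rfl fun i hi => if_neg fun h0 => ?_
      exact Finset.ne_of_mem_erase hi (Fin.ext (h0.trans h.symm))
    rw [hle]
    linarith
  · exact le_rfl

theorem metaInit_pos (hM : ∃ π, M.IsProper π) {K N : ℕ} (hK : 1 ≤ K) (j : Fin N) :
    0 < M.metaInit K N j := by
  refine lt_of_lt_of_le ?_ (metaInit_ge hM hK j)
  have hη := metaRate_pos hM hK (M := M)
  have hN : (0 : ℝ) < N := by exact_mod_cast j.pos
  exact div_pos (hη j) (mul_pos hN (hη 0))

theorem sum_metaInit (M : SSP S A) (K : ℕ) {N : ℕ} (hN : 0 < N) :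
    ∑ j, M.metaInit K N j = 1 := by
  obtain ⟨n, rfl⟩ : ∃ n, N = n + 1 := ⟨N - 1, by omega⟩
  rw [Fin.sum_univ_succ]
  simp [metaInit, Fin.sum_univ_succ]

theorem metaInit_mem (hM : ∃ π, M.IsProper π) {K N : ℕ} (hK : 1 ≤ K) (hN : 0 < N) :
    M.metaInit K N ∈ stdSimplex ℝ (Fin N) :=
  ⟨fun j => (metaInit_pos hM hK j).le, sum_metaInit M K hN⟩

theorem metaWeights_spec {N : ℕ} (hN : 0 < N) (K : ℕ) (c : (Σ s, A s) → ℝ)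
    (cs : List ((Σ s, A s) → ℝ)) :
    M.metaWeights K N (c :: cs) ∈ stdSimplex ℝ (Fin N) ∧ IsMinOn (fun p : Fin N → ℝ =>
      ∑ j : Fin N, p j *
          (M.workerLoss K cs c j + 4 * M.metaRate K j * M.workerLoss K cs c j ^ 2)
        + bregman (fun j : Fin N => M.metaRate K j) p (M.metaWeights K N cs))
      (stdSimplex ℝ (Fin N)) (M.metaWeights K N (c :: cs)) :=
  argminOn_spec (isCompact_stdSimplex _ _) ⟨_, single_mem_stdSimplex ℝ (⟨0, hN⟩ : Fin N)⟩
    (continuous_linear_add_bregman _ _ _)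

theorem metaWeights_mem (hM : ∃ π, M.IsProper π) {K N : ℕ} (hK : 1 ≤ K) (hN : 0 < N)
    (cs : List ((Σ s, A s) → ℝ)) : M.metaWeights K N cs ∈ stdSimplex ℝ (Fin N) := by
  cases cs with
  | nil => exact metaInit_mem hM hK hN
  | cons c cs => exact (metaWeights_spec hN K c cs).1

theorem metaWeights_support (hM : ∃ π, M.IsProper π) {K N : ℕ} (hK : 1 ≤ K) (hN : 0 < N)
    (cs : List ((Σ s, A s) → ℝ)) :
    ∀ p ∈ stdSimplex ℝ (Fin N), ∀ j, M.metaWeights K N cs j = 0 → p j = 0 := by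
  intro p hp j
  cases cs with
  | nil => exact fun h => absurd h (metaInit_pos hM hK j).ne'
  | cons c cs =>
    exact support_of_isMinOn (convex_stdSimplex ℝ _) (fun q hq => hq.1)
      (fun j : Fin N => metaRate_pos hM hK j) (metaWeights_spec hN K c cs).1
      (isMinOn_of_linear_add_bregman (metaWeights_spec hN K c cs).2) hp j

/-- The total expected loss of the meta algorithm along a list of cost functions. -/
def cumMetaLoss (M : SSP S A) (K N : ℕ) : List ((Σ s, A s) → ℝ) → ℝ
  | [] => 0
  | c :: cs => ∑ j : Fin N, M.metaWeights K N cs j * M.workerLoss K cs c j + cumMetaLoss M K N cs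

theorem workerLoss_nonneg (hM : ∃ π, M.IsProper π) (K : ℕ) (cs : List ((Σ s, A s) → ℝ))
    {c : (Σ s, A s) → ℝ} (hc : ∀ x, c x ∈ Set.Icc (0 : ℝ) 1) (j : ℕ) :
    0 ≤ M.workerLoss K cs c j :=
  sum_mul_cost_nonneg (worker_mem hM K (fastTime_le_grid hM j) cs) hc

theorem workerLoss_le (hM : ∃ π, M.IsProper π) (K : ℕ) (cs : List ((Σ s, A s) → ℝ))
    {c : (Σ s, A s) → ℝ} (hc : ∀ x, c x ∈ Set.Icc (0 : ℝ) 1) (j : ℕ) :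
    M.workerLoss K cs c j ≤ M.grid j :=
  sum_mul_cost_le (worker_mem hM K (fastTime_le_grid hM j) cs) hc

/-- This fixes the constant 32 in `metaRate`: `16 T² ≤ 32 D K T` is the condition `T ≤ 2 D K`. It
makes each correction at most the loss it corrects. -/
theorem four_mul_metaRate_mul_grid_le (hM : ∃ π, M.IsProper π) {K : ℕ} (hK : 1 ≤ K) {j : ℕ}
    (hj : M.grid j ≤ 2 * (M.diameter * K)) : 4 * M.metaRate K j * M.grid j ≤ 1 := by
  have hD := one_le_diameter hM
  have hK' : (1 : ℝ) ≤ K := by exact_mod_cast hK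
  have h0 := M.grid_pos j
  have hX : 0 < √(32 * M.diameter * K * M.grid j) := Real.sqrt_pos.2 (by positivity)
  have h1 : 4 * M.grid j ≤ √(32 * M.diameter * K * M.grid j) :=
    Real.le_sqrt_of_sq_le (by nlinarith)
  unfold metaRate
  rw [mul_one_div, div_mul_eq_mul_div, div_le_one hX]
  exact h1

/-- The corrected loss is at most `2 ℓ`, so the stability term `η/2 · p (2 ℓ)²` is below the
correction `4 η p ℓ²` that the algorithm itself pays. What survives is the correction of worker `j`
alone, bounded through `ℓ ≤ grid j`; no larger scale enters. -/
theorem cumMetaLoss_sub_le_bregman (hM : ∃ π, M.IsProper π) {K N : ℕ} (hK : 1 ≤ K)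
    (hN : ∀ j : Fin N, M.grid j ≤ 2 * (M.diameter * K)) (j : Fin N)
    {cs : List ((Σ s, A s) → ℝ)} (hcs : UnitCosts cs) :
    M.cumMetaLoss K N cs - M.cumWorkerLoss K (M.grid j) cs
      ≤ bregman (fun i : Fin N => M.metaRate K i) (Pi.single j 1) (M.metaInit K N)
        - bregman (fun i : Fin N => M.metaRate K i) (Pi.single j 1) (M.metaWeights K N cs)
        + 4 * M.metaRate K j * M.grid j * M.cumWorkerLoss K (M.grid j) cs := by
  induction cs with
  | nil => simp [cumMetaLoss, cumWorkerLoss, metaWeights]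
  | cons c cs ih =>
    have hc := hcs c (by simp)
    have ih := ih fun d hd => hcs d (by simp [hd])
    have hw := metaWeights_mem hM hK j.pos cs
    have hη := metaRate_pos hM hK (M := M)
    have hl0 := workerLoss_nonneg hM K cs hc
    have hl1 := workerLoss_le hM K cs hc
    have hstep := mirror_descent_step (convex_stdSimplex ℝ (Fin N)) (fun q hq => hq.1)
      (fun i : Fin N => hη i) (c := fun i : Fin N =>
        M.workerLoss K cs c i + 4 * M.metaRate K i * M.workerLoss K cs c i ^ 2)
      (fun i => add_nonneg (hl0 i) (mul_nonneg (by linarith [hη i]) (sq_nonneg _)))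
      hw.1 (metaWeights_support hM hK j.pos cs)
      (metaWeights_spec j.pos K c cs).1 (metaWeights_spec j.pos K c cs).2
      (single_mem_stdSimplex ℝ j)
    have hsingle : ∑ i : Fin N, (Pi.single j (1 : ℝ) : Fin N → ℝ) i *
        (M.workerLoss K cs c i + 4 * M.metaRate K i * M.workerLoss K cs c i ^ 2)
        = M.workerLoss K cs c j + 4 * M.metaRate K j * M.workerLoss K cs c j ^ 2 := by
      simp [Pi.single_apply]
    have hsq : ∑ i : Fin N, M.metaRate K i / 2 * (M.metaWeights K N cs i *
        (M.workerLoss K cs c i + 4 * M.metaRate K i * M.workerLoss K cs c i ^ 2) ^ 2)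
        ≤ ∑ i : Fin N, M.metaWeights K N cs i *
          (4 * M.metaRate K i * M.workerLoss K cs c i ^ 2) := by
      refine Finset.sum_le_sum fun i _ => ?_
      have h4 : 4 * M.metaRate K i * M.workerLoss K cs c i ≤ 1 :=
        (mul_le_mul_of_nonneg_left (hl1 i) (by linarith [hη i])).trans
          (four_mul_metaRate_mul_grid_le hM hK (hN i))
      have h5 : M.workerLoss K cs c i + 4 * M.metaRate K i * M.workerLoss K cs c i ^ 2
          ≤ 2 * M.workerLoss K cs c i := by nlinarith [hl0 i]
      have h6 := pow_le_pow_left₀ (add_nonneg (hl0 i)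
        (mul_nonneg (by linarith [hη i]) (sq_nonneg _))) h5 2
      have h7 := mul_le_mul_of_nonneg_left h6
        (mul_nonneg (half_pos (hη i)).le (hw.1 i))
      have h8 : 0 ≤ M.metaRate K i * M.metaWeights K N cs i * M.workerLoss K cs c i ^ 2 :=
        mul_nonneg (mul_nonneg (hη i).le (hw.1 i)) (sq_nonneg _)
      nlinarith
    have hj : 4 * M.metaRate K j * M.workerLoss K cs c j ^ 2
        ≤ 4 * M.metaRate K j * M.grid j * M.workerLoss K cs c j := by
      rw [mul_assoc (4 * M.metaRate K j)]
      refine mul_le_mul_of_nonneg_left ?_ (by linarith [hη j])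
      nlinarith [hl0 j, hl1 j]
    rw [hsingle] at hstep
    simp only [mul_add, Finset.sum_add_distrib] at hstep
    simp only [cumMetaLoss, cumWorkerLoss, mul_add]
    change _ - (M.workerLoss K cs c j + _) ≤ _ - _ + (_ * M.workerLoss K cs c j + _)
    linarith

theorem bregman_single {N : ℕ} (η p : Fin N → ℝ) (j : Fin N) :
    bregman η (Pi.single j 1) p = 1 / η j * (-Real.log (p j) - 1) + ∑ i, 1 / η i * p i := by
  rw [bregman_eq_sum, ← Finset.add_sum_erase _ _ (Finset.mem_univ j),
    ← Finset.add_sum_erase _ (fun i => 1 / η i * p i) (Finset.mem_univ j), ← add_assoc]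
  congr 1
  · simp only [bregmanTerm, Pi.single_eq_same, Real.log_one]; ring
  · refine Finset.sum_congr rfl fun i hi => ?_
    rw [Pi.single_eq_of_ne (Finset.ne_of_mem_erase hi), bregmanTerm]
    ring

/-- The initial weights make `p i / η i` equal to `1 / (N η 0)` for all `i ≠ 0`, so the linear part
is at most `2 / η 0` despite the different scales. The price `-log (p j) ≤ log N + j log 2` is
linear in `N`, which is itself logarithmic in `B`. -/
theorem bregman_single_metaInit_le (hM : ∃ π, M.IsProper π) {K N : ℕ} (hK : 1 ≤ K)
    (j : Fin N) :
    bregman (fun i : Fin N => M.metaRate K i) (Pi.single j 1) (M.metaInit K N)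
      ≤ 1 / M.metaRate K j * (1 + 2 * N) := by
  have hη := metaRate_pos hM hK (M := M)
  have hN : (0 : ℝ) < N := by exact_mod_cast j.pos
  have hsimp := metaInit_mem hM hK j.pos (M := M) (K := K)
  have hle1 : ∀ i, M.metaInit K N i ≤ 1 := fun i =>
    (Finset.single_le_sum (fun k _ => hsimp.1 k) (Finset.mem_univ i)).trans hsimp.2.le
  have hsum : ∑ i : Fin N, 1 / M.metaRate K i * M.metaInit K N i ≤ 2 / M.metaRate K j := by
    have h1 : ∀ i : Fin N, 1 / M.metaRate K i * M.metaInit K N i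
        ≤ (if i = (⟨0, j.pos⟩ : Fin N) then 1 / M.metaRate K 0 else 0)
          + 1 / (N * M.metaRate K 0) := by
      intro i
      have hp : 0 ≤ 1 / (N * M.metaRate K 0) := by have := hη 0; positivity
      split_ifs with h
      · subst h
        have := mul_le_mul_of_nonneg_left (hle1 ⟨0, j.pos⟩) (one_div_pos.2 (hη 0)).le
        linarith
      · have h0 : i.1 ≠ 0 := fun h' => h (Fin.ext h')
        rw [metaInit, if_neg h0, zero_add]
        have := (hη i).ne'
        have := (hη 0).ne'
        apply le_of_eq
        field_simp
    refine (Finset.sum_le_sum fun i _ => h1 i).trans ?_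
    rw [Finset.sum_add_distrib, Finset.sum_ite_eq' , if_pos (Finset.mem_univ _),
      Finset.sum_const, Finset.card_univ, Fintype.card_fin, nsmul_eq_mul]
    have h2 : (N : ℝ) * (1 / (N * M.metaRate K 0)) = 1 / M.metaRate K 0 := by
      have := (hη 0).ne'; field_simp
    have h3 := one_div_le_one_div_of_le (hη j) (metaRate_anti hM hK (M := M) j)
    rw [h2, show 2 / M.metaRate K j = 1 / M.metaRate K j + 1 / M.metaRate K j by ring]
    linarith
  have hlog : -Real.log (M.metaInit K N j) ≤ 2 * N := by
    have h1 : 1 / ((N : ℝ) * 2 ^ (j : ℕ)) ≤ M.metaInit K N j := by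
      refine le_trans ?_ (metaInit_ge hM hK j)
      rw [div_le_div_iff₀ (by positivity) (mul_pos hN (hη 0))]
      have := mul_le_mul_of_nonneg_left (metaRate_zero_le hM hK (M := M) j) hN.le
      linarith
    have h2 := Real.log_le_log (by positivity) h1
    rw [one_div, Real.log_inv, Real.log_mul hN.ne' (by positivity), Real.log_pow] at h2
    have h3 : Real.log N ≤ N := (Real.log_le_sub_one_of_pos hN).trans (by linarith)
    have h4 : (j : ℝ) ≤ N := by exact_mod_cast j.2.le
    have h5 := Real.log_two_lt_d9
    have h6 : (j : ℝ) * Real.log 2 ≤ N := by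
      have : (0 : ℝ) ≤ (j : ℕ) := Nat.cast_nonneg _
      nlinarith
    linarith
  rw [bregman_single]
  have h7 := mul_le_mul_of_nonneg_left hlog (one_div_pos.2 (hη j)).le
  have h8 : 2 / M.metaRate K j = 2 * (1 / M.metaRate K j) := by ring
  linarith

/-- The tuning of the meta algorithm against one worker. -/
theorem tuned_meta_bound {T X Λ R cw U : ℝ} (hT : 0 < T) (hX : 0 < X) (hTX : T ≤ 2 * X)
    (hΛ : 1 ≤ Λ) (hU : U ≤ X) (hcw : cw - U ≤ 12 * Λ * √(T * X))
    (hR : R - cw ≤ √(32 * X * T) * (5 * Λ) + 4 * (1 / √(32 * X * T)) * T * cw) :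
    R - U ≤ 56 * Λ * √(T * X) := by
  set r := √(T * X) with hr
  have hr0 : 0 < r := Real.sqrt_pos.2 (by positivity)
  have hrsq : r ^ 2 = T * X := Real.sq_sqrt (by positivity)
  have hrX : r ≤ 3 / 2 * X := by
    refine le_of_sq_le_sq ?_ (by positivity)
    nlinarith
  have hw : √(32 * X * T) = √32 * r := by
    rw [hr, ← Real.sqrt_mul (by norm_num)]; congr 1; ring
  have h32 : √32 ≤ 6 := by
    rw [Real.sqrt_le_left (by norm_num)]; norm_num
  have h32' : (28 : ℝ) / 5 ≤ √32 := Real.le_sqrt_of_sq_le (by norm_num)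
  -- From `cw ≤ X + 12 Λ r` and `r ≤ 3/2 X`. The final 56 is 12 (worker) plus 30 (initial
  -- divergence) plus 14 (correction).
  have hcw2 : cw ≤ 19 * Λ * X := by nlinarith [mul_le_mul_of_nonneg_left hrX (by linarith : 0 ≤ Λ)]
  have hterm : 4 * (1 / √(32 * X * T)) * T * cw ≤ 14 * Λ * r := by
    rw [hw]
    have h1 : 4 * (1 / (√32 * r)) * T * cw = 4 * T * cw / (√32 * r) := by ring
    rw [h1, div_le_iff₀ (by positivity)]
    have h2 : 4 * T * cw ≤ 76 * Λ * (T * X) := by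
      have := mul_le_mul_of_nonneg_left hcw2 (by linarith : 0 ≤ 4 * T)
      linarith
    rw [← hrsq] at h2
    have h3 : 0 ≤ Λ * r ^ 2 := by positivity
    have h4 := mul_le_mul_of_nonneg_right h32' h3
    nlinarith
  have hfirst : √(32 * X * T) * (5 * Λ) ≤ 30 * Λ * r := by
    rw [hw]
    have h3 : 0 ≤ Λ * r := by positivity
    have h4 := mul_le_mul_of_nonneg_right h32 h3
    linarith
  linarith

theorem log_le_log_card_mul (hM : ∃ π, M.IsProper π) {B : ℝ} (hB : 1 ≤ B) :
    Real.log B ≤ Real.log (Fintype.card (Σ s, A s) * B) := by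
  have hcard : (1 : ℝ) ≤ Fintype.card (Σ s, A s) := by exact_mod_cast card_pos_of_model hM
  exact Real.log_le_log (by linarith) (by nlinarith)

/-- The regret of the meta algorithm against a proper policy covered by the grid, along an
arbitrary sequence of cost functions. -/
theorem cumMetaLoss_sub_le (hM : ∃ π, M.IsProper π) {K : ℕ} (hK : 1 ≤ K) {B : ℝ}
    (hBX : B ≤ M.diameter * K) {π : (s : S) → A s} (hπ : M.IsProper π)
    (hπB : M.hittingTime π M.init ≤ B) {cs : List ((Σ s, A s) → ℝ)} (hcs : UnitCosts cs)
    (hU : (cs.map fun c => M.costToGo c π M.init).sum ≤ M.diameter * K) :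
    M.cumMetaLoss K (M.gridSize B) cs - (cs.map fun c => M.costToGo c π M.init).sum
      ≤ 84 * (1 + Real.log (Fintype.card (Σ s, A s) * B))
        * √(M.diameter * M.hittingTime π M.init * K) := by
  set X := M.diameter * K with hXdef
  set Tp := M.hittingTime π M.init with hTp
  set Λ := 1 + Real.log (Fintype.card (Σ s, A s) * B) with hΛdef
  have hTp1 : 1 ≤ Tp := hπ.one_le_hittingTime _
  have hB : 1 ≤ B := hTp1.trans hπB
  have hX : 0 < X := by linarith
  have hlogB := Real.log_nonneg hB
  have hlog := log_le_log_card_mul hM hB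
  have hΛ : 1 ≤ Λ := by linarith
  obtain ⟨j, hj1, hj2⟩ := exists_grid hM (fastTime_le hπ M.init) hπB
  have hgrid : ∀ i : Fin (M.gridSize B), M.grid i ≤ 2 * X := fun i =>
    (grid_le hB i.2).trans (by linarith)
  set T := M.grid j with hT
  have hT0 : 0 < T := M.grid_pos j
  have hL : Real.log (Fintype.card (Σ s, A s) * T) ≤ Λ := by
    have hcard : (0 : ℝ) < Fintype.card (Σ s, A s) := by exact_mod_cast card_pos_of_model hM
    have h1 : Fintype.card (Σ s, A s) * T ≤ 2 * (Fintype.card (Σ s, A s) * B) := by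
      have := mul_le_mul_of_nonneg_left (grid_le hB j.2) hcard.le
      linarith
    have h2 := Real.log_le_log (by positivity) h1
    rw [Real.log_mul (x := 2) two_ne_zero (mul_pos hcard (by linarith)).ne'] at h2
    linarith [Real.log_two_lt_d9]
  have hu := hπ.detOccupancy_mem hj1
  have hcost : (cs.map fun c => ∑ x, M.detOccupancy π x * c x)
      = cs.map fun c => M.costToGo c π M.init :=
    List.map_congr_left fun c _ => hπ.sum_detOccupancy_mul c
  have hw := cumWorkerLoss_sub_le hM hK (fastTime_le_grid hM j) (hgrid j) hL hΛ hu hcs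
    (by rw [hcost]; exact hU)
  rw [hcost] at hw
  have hm := cumMetaLoss_sub_le_bregman hM hK hgrid j hcs
  have hbr0 := bregman_nonneg (fun i : Fin (M.gridSize B) => metaRate_pos hM hK (M := M) i)
    (single_mem_stdSimplex ℝ j).1 (metaWeights_mem hM hK j.pos cs).1
    (metaWeights_support hM hK j.pos cs _ (single_mem_stdSimplex ℝ j))
  have hbr1 := bregman_single_metaInit_le hM hK j
  have hrate : M.metaRate K j = 1 / √(32 * X * T) := by
    rw [metaRate, hXdef]; congr 2; ring
  have hN5 : 1 + 2 * (M.gridSize B : ℝ) ≤ 5 * Λ := by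
    have := gridSize_le (M := M) hB
    linarith
  rw [hrate, one_div_one_div] at hbr1
  rw [hrate] at hm
  have hN6 := mul_le_mul_of_nonneg_left hN5 (Real.sqrt_nonneg (32 * X * T))
  have hfin := tuned_meta_bound hT0 hX (hgrid j) hΛ hU hw
    (R := M.cumMetaLoss K (M.gridSize B) cs) (by linarith)
  -- The grid overshoots `Tp` by at most a factor 2, and `√2 ≤ 3/2` turns 56 into 84.
  have hsq : √(T * X) ≤ 3 / 2 * √(M.diameter * Tp * K) := by
    refine Real.sqrt_le_iff.2 ⟨by positivity, ?_⟩
    have hD : M.diameter * Tp * K = Tp * X := by rw [hXdef]; ring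
    rw [hD, mul_pow, Real.sq_sqrt (by positivity)]
    nlinarith [mul_le_mul_of_nonneg_right hj2 hX.le, mul_pos (by linarith : 0 < Tp) hX]
  have := mul_le_mul_of_nonneg_left hsq (by linarith : 0 ≤ 56 * Λ)
  linarith

end Algorithm

/-! ### The law of histories and the passage from pathwise losses to expectations -/

section Histories

/-- Lists of length `n + 1` as pairs of a tail and a head. -/
def consEquiv (α : Type*) (n : ℕ) :
    {l : List α // l.length = n} × α ≃ {l : List α // l.length = n + 1} where
  toFun p := ⟨p.2 :: p.1.1, by simp [p.1.2]⟩
  invFun l := (⟨l.1.tail, by simp [l.2]⟩, l.1.head (by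
    intro h
    have := l.2
    simp [h] at this))
  left_inv p := by simp
  right_inv l := by simp

theorem summable_weight_mul {α : Type*} {p g : α → ℝ} (hp : Summable p) (hp0 : ∀ x, 0 ≤ p x)
    {b : ℝ} (hg0 : ∀ x, 0 ≤ g x) (hg : ∀ x, g x ≤ b) : Summable fun x => p x * g x :=
  Summable.of_nonneg_of_le (fun x => mul_nonneg (hp0 x) (hg0 x))
    (fun x => mul_le_mul_of_nonneg_left (hg x) (hp0 x)) (hp.mul_right b)

theorem hasSum_prod_of_nonneg {α β : Type*} {f : α × β → ℝ} (hf : ∀ x, 0 ≤ f x) {g : α → ℝ}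
    (hg : ∀ a, HasSum (fun b => f (a, b)) (g a)) {s : ℝ} (hs : HasSum g s) : HasSum f s := by
  have hsum : Summable f := by
    rw [summable_prod_of_nonneg hf]
    refine ⟨fun a => (hg a).summable, ?_⟩
    simpa only [(hg _).tsum_eq] using hs.summable
  have h1 := hsum.hasSum.prod_fiberwise hg
  rw [hs.unique h1]
  exact hsum.hasSum

variable {S : Type*} {A : S → Type*}

theorem length_costs {N : ℕ} (adv : Adversary A N) (h : History A N) :
    (costs adv h).length = h.length := by
  induction h with
  | nil => rfl
  | cons e h ih => simp [costs, ih]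

theorem unitCosts_costs {N : ℕ} {adv : Adversary A N}
    (hadv : ∀ h x, adv h x ∈ Set.Icc (0 : ℝ) 1) (h : History A N) :
    UnitCosts (costs adv h) := by
  induction h with
  | nil => intro c hc; simp [costs] at hc
  | cons e h ih =>
    intro c hc
    rcases List.mem_cons.1 hc with rfl | hc
    · exact hadv h
    · exact ih c hc

variable [Fintype S] [DecidableEq S] [∀ s, Fintype (A s)] {M : SSP S A}

theorem learnerCost_nonneg {N : ℕ} {adv : Adversary A N}
    (hadv : ∀ h x, adv h x ∈ Set.Icc (0 : ℝ) 1) (h : History A N) : 0 ≤ learnerCost adv h := by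
  induction h with
  | nil => exact le_rfl
  | cons e h ih => exact add_nonneg (trajCost_nonneg (fun x => (hadv h x).1) _) ih

theorem sum_costToGo_le {π : (s : S) → A s} (hπ : M.IsProper π)
    {cs : List ((Σ s, A s) → ℝ)} (hcs : UnitCosts cs) :
    (cs.map fun c => M.costToGo c π M.init).sum ≤ cs.length * M.hittingTime π M.init := by
  have := List.sum_le_card_nsmul (cs.map fun c => M.costToGo c π M.init)
    (M.hittingTime π M.init) (by
      intro y hy
      obtain ⟨c, hc, rfl⟩ := List.mem_map.1 hy
      exact hπ.costToGo_le_hittingTime (hcs c hc) _)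
  simpa using this

theorem sum_costToGo_nonneg {cs : List ((Σ s, A s) → ℝ)} (hcs : UnitCosts cs)
    (π : (s : S) → A s) : 0 ≤ (cs.map fun c => M.costToGo c π M.init).sum := by
  refine List.sum_nonneg fun y hy => ?_
  obtain ⟨c, hc, rfl⟩ := List.mem_map.1 hy
  exact costToGo_nonneg (fun x => (hcs c hc x).1) _ _

/-- The conditional probability that the next episode is `e`, given the past `h`. -/
def episodeProb (M : SSP S A) (K : ℕ) {N : ℕ} (adv : Adversary A N) (h : History A N)
    (e : Fin N × Traj A) : ℝ :=
  M.metaWeights K N (costs adv h) e.1 *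
    M.trajProb (inducedPolicy (M.worker K (M.grid e.1) (costs adv h))) M.init e.2

section

variable {K N : ℕ} {adv : Adversary A N}

theorem nonempty_actions (hM : ∃ π, M.IsProper π) (s : S) : Nonempty (A s) :=
  hM.elim fun π _ => ⟨π s⟩

theorem isPolicy_worker (hM : ∃ π, M.IsProper π) (j : ℕ) (cs : List ((Σ s, A s) → ℝ)) :
    IsPolicy (inducedPolicy (M.worker K (M.grid j) cs)) :=
  have := nonempty_actions hM
  isPolicy_inducedPolicy (worker_mem hM K (fastTime_le_grid hM j) cs).1

theorem episodeProb_nonneg (hM : ∃ π, M.IsProper π) (hK : 1 ≤ K) (hN : 0 < N)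
    (h : History A N) (e : Fin N × Traj A) : 0 ≤ M.episodeProb K adv h e :=
  mul_nonneg ((metaWeights_mem hM hK hN _).1 _)
    (M.trajProb_nonneg (isPolicy_worker hM e.1 _) _ _)

theorem historyProb_nonneg (hM : ∃ π, M.IsProper π) (hK : 1 ≤ K) (hN : 0 < N)
    (h : History A N) : 0 ≤ M.historyProb K adv h := by
  induction h with
  | nil => exact zero_le_one
  | cons e h ih => exact mul_nonneg ih (episodeProb_nonneg hM hK hN h e)

theorem hasSum_episodeProb (hM : ∃ π, M.IsProper π) (hK : 1 ≤ K) (hN : 0 < N)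
    (h : History A N) : HasSum (M.episodeProb K adv h) 1 := by
  have := nonempty_actions hM
  have hs := hasSum_fintype (M.metaWeights K N (costs adv h))
  rw [(metaWeights_mem hM hK hN _).2] at hs
  refine hasSum_prod_of_nonneg (episodeProb_nonneg hM hK hN h) (fun j => ?_) hs
  have := (hasSum_trajProb_inducedPolicy
    (worker_mem hM K (fastTime_le_grid hM j) (costs adv h))).mul_left
    (M.metaWeights K N (costs adv h) j)
  rw [mul_one] at this
  exact this

/-- The expected loss of the meta algorithm in the episode that follows `h`. -/
def metaLoss (M : SSP S A) (K : ℕ) {N : ℕ} (adv : Adversary A N) (h : History A N) : ℝ :=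
  ∑ j : Fin N, M.metaWeights K N (costs adv h) j * M.workerLoss K (costs adv h) (adv h) j

/-- The conditional mean cost of an episode averages the induced policies' costs over the meta
weights. It is only bounded by `metaLoss`, since each policy may cost less than its occupancy
vector. -/
theorem exists_hasSum_episodeCost (hM : ∃ π, M.IsProper π) (hK : 1 ≤ K) (hN : 0 < N)
    (hadv : ∀ h x, adv h x ∈ Set.Icc (0 : ℝ) 1) (h : History A N) :
    ∃ m, m ≤ M.metaLoss K adv h ∧
      HasSum (fun e => M.episodeProb K adv h e * trajCost (adv h) e.2) m := by
  have := nonempty_actions hM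
  have hc : ∀ x, 0 ≤ adv h x := fun x => (hadv h x).1
  have hw := fun j : ℕ => worker_mem hM K (fastTime_le_grid hM j) (costs adv h)
  refine ⟨∑ j : Fin N, M.metaWeights K N (costs adv h) j * ∑' τ, M.trajProb
    (inducedPolicy (M.worker K (M.grid j) (costs adv h))) M.init τ * trajCost (adv h) τ, ?_, ?_⟩
  · exact Finset.sum_le_sum fun j _ => mul_le_mul_of_nonneg_left
      (tsum_cost_inducedPolicy_le (hw j) hc) ((metaWeights_mem hM hK hN _).1 j)
  · refine hasSum_prod_of_nonneg (fun e => mul_nonneg (episodeProb_nonneg hM hK hN h e)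
      (trajCost_nonneg hc _)) (fun j => ?_) (hasSum_fintype _)
    have := (summable_cost_inducedPolicy (hw j) hc).hasSum.mul_left
      (M.metaWeights K N (costs adv h) j)
    simpa only [episodeProb, mul_assoc] using this

theorem metaLoss_nonneg (hM : ∃ π, M.IsProper π) (hK : 1 ≤ K) (hN : 0 < N)
    (hadv : ∀ h x, adv h x ∈ Set.Icc (0 : ℝ) 1) (h : History A N) :
    0 ≤ M.metaLoss K adv h :=
  Finset.sum_nonneg fun j _ => mul_nonneg ((metaWeights_mem hM hK hN _).1 j)
    (workerLoss_nonneg hM K _ (hadv h) j)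

theorem metaLoss_le (hM : ∃ π, M.IsProper π) (hK : 1 ≤ K) (hN : 0 < N)
    (hadv : ∀ h x, adv h x ∈ Set.Icc (0 : ℝ) 1) (h : History A N) :
    M.metaLoss K adv h ≤ M.grid N := by
  have hw := metaWeights_mem hM hK hN (M := M) (K := K) (costs adv h)
  calc _ ≤ ∑ j : Fin N, M.metaWeights K N (costs adv h) j * M.grid N := by
        refine Finset.sum_le_sum fun j _ => mul_le_mul_of_nonneg_left
          ((workerLoss_le hM K _ (hadv h) j).trans ?_) (hw.1 j)
        exact pow_le_pow_right₀ (by norm_num) (by omega)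
    _ = _ := by rw [← Finset.sum_mul, hw.2, one_mul]

theorem cumMetaLoss_nonneg (hM : ∃ π, M.IsProper π) (hK : 1 ≤ K) (hN : 0 < N)
    (hadv : ∀ h x, adv h x ∈ Set.Icc (0 : ℝ) 1) (h : History A N) :
    0 ≤ M.cumMetaLoss K N (costs adv h) := by
  induction h with
  | nil => exact le_rfl
  | cons e h ih => exact add_nonneg (metaLoss_nonneg hM hK hN hadv h) ih

/-- The tower property for the last episode. -/
theorem hasSum_historyProb_succ (hM : ∃ π, M.IsProper π) (hK : 1 ≤ K) (hN : 0 < N) {n : ℕ}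
    {F : History A N → ℝ} (hF : ∀ h, 0 ≤ F h) {G : History A N → ℝ}
    (hG : ∀ h, HasSum (fun e => M.episodeProb K adv h e * F (e :: h)) (G h)) {s : ℝ}
    (hs : HasSum (fun h : {h : History A N // h.length = n} => M.historyProb K adv h.1 * G h.1) s) :
    HasSum (fun h : {h : History A N // h.length = n + 1} => M.historyProb K adv h.1 * F h.1)
      s := by
  rw [← (consEquiv (Fin N × Traj A) n).hasSum_iff]
  refine hasSum_prod_of_nonneg
    (fun p => mul_nonneg (historyProb_nonneg hM hK hN _) (hF _)) (fun h => ?_) hs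
  have := (hG h.1).mul_left (M.historyProb K adv h.1)
  simp only [← mul_assoc] at this
  exact this

/-- Conditioning on the last episode replaces its cost by a mean that is at most `metaLoss`. Total
mass and both expectations are carried through one induction, because the tower step needs
convergence of all of them; the bound of `metaLoss` by `grid N` supplies it. -/
theorem expectation_learnerCost_le (hM : ∃ π, M.IsProper π) (hK : 1 ≤ K) (hN : 0 < N)
    (hadv : ∀ h x, adv h x ∈ Set.Icc (0 : ℝ) 1) (n : ℕ) :
    HasSum (fun h : {h : History A N // h.length = n} => M.historyProb K adv h.1) 1 ∧
    ∃ a b, a ≤ b ∧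
      HasSum (fun h : {h : History A N // h.length = n} =>
        M.historyProb K adv h.1 * learnerCost adv h.1) a ∧
      HasSum (fun h : {h : History A N // h.length = n} =>
        M.historyProb K adv h.1 * M.cumMetaLoss K N (costs adv h.1)) b := by
  induction n with
  | zero =>
    have huniq : ∀ f : History A N → ℝ,
        HasSum (fun h : {h : History A N // h.length = 0} => f h.1) (f []) := by
      intro f
      have h := hasSum_single (f := fun h : {h : History A N // h.length = 0} => f h.1)
        ⟨[], rfl⟩ fun h hne => absurd (Subtype.ext (List.length_eq_zero_iff.1 h.2)) hne
      exact h
    exact ⟨huniq (M.historyProb K adv), _, _, by simp [learnerCost, costs, cumMetaLoss],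
      huniq fun h => M.historyProb K adv h * learnerCost adv h,
      huniq fun h => M.historyProb K adv h * M.cumMetaLoss K N (costs adv h)⟩
  | succ n ih =>
    obtain ⟨h1, a, b, hab, ha, hb⟩ := ih
    choose m hm hmsum using fun h => exists_hasSum_episodeCost hM hK hN hadv h (M := M) (K := K)
    have hone := hasSum_episodeProb hM hK hN (M := M) (K := K) (adv := adv)
    have hp0 : ∀ h : {h : History A N // h.length = n}, 0 ≤ M.historyProb K adv h.1 :=
      fun h => historyProb_nonneg hM hK hN h.1
    have hm0 : ∀ h, 0 ≤ m h := fun h => (hmsum h).nonneg fun e =>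
      mul_nonneg (episodeProb_nonneg hM hK hN h e) (trajCost_nonneg (fun x => (hadv h x).1) _)
    have hml := metaLoss_le hM hK hN hadv (M := M) (K := K)
    have hsm := summable_weight_mul h1.summable hp0 (fun h => hm0 h.1)
      (fun h => (hm h.1).trans (hml h.1))
    have hsl := summable_weight_mul h1.summable hp0
      (fun h => metaLoss_nonneg hM hK hN hadv (M := M) (K := K) h.1) (fun h => hml h.1)
    refine ⟨?_, (∑' h : {h : History A N // h.length = n}, M.historyProb K adv h.1 * m h.1) + a,
      (∑' h : {h : History A N // h.length = n},
        M.historyProb K adv h.1 * M.metaLoss K adv h.1) + b, ?_, ?_, ?_⟩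
    · have := hasSum_historyProb_succ hM hK hN (M := M) (K := K) (adv := adv) (n := n)
        (F := fun _ => 1) (G := fun _ => 1) (fun _ => zero_le_one)
        (fun h => by simpa using hone h) (s := 1) (by simpa using h1)
      simpa using this
    · exact add_le_add (hsm.tsum_le_tsum
        (fun h => mul_le_mul_of_nonneg_left (hm h.1) (hp0 h)) hsl) hab
    · refine hasSum_historyProb_succ hM hK hN (learnerCost_nonneg hadv)
        (G := fun h => m h + learnerCost adv h) (fun h => ?_) ?_
      · have := (hmsum h).add ((hone h).mul_right (learnerCost adv h))
        simpa only [learnerCost, mul_add, one_mul] using this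
      · simpa only [mul_add] using hsm.hasSum.add ha
    · refine hasSum_historyProb_succ hM hK hN (cumMetaLoss_nonneg hM hK hN hadv)
        (G := fun h => M.metaLoss K adv h + M.cumMetaLoss K N (costs adv h)) (fun h => ?_) ?_
      · have := (hone h).mul_right (M.metaLoss K adv h + M.cumMetaLoss K N (costs adv h))
        rw [one_mul] at this
        exact this
      · simpa only [mul_add] using hsl.hasSum.add hb

end

/-- The regret of the meta algorithm along a fixed sequence of cost functions, against a best
policy that the grid covers or whose hitting time is at least `D K`. -/
theorem cumMetaLoss_sub_best_le (hM : ∃ π, M.IsProper π) {K : ℕ} (hK : 1 ≤ K) {B : ℝ}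
    (hBX : B ≤ M.diameter * K) (hTB : M.fastTime M.init ≤ B) {cs : List ((Σ s, A s) → ℝ)}
    (hlen : cs.length = K) (hcs : UnitCosts cs) {π : (s : S) → A s}
    (hπ : M.IsBestInHindsight cs π)
    (hcov : M.hittingTime π M.init ≤ B ∨ M.diameter * K ≤ M.hittingTime π M.init) :
    M.cumMetaLoss K (M.gridSize B) cs - (cs.map fun c => M.costToGo c π M.init).sum
      ≤ 85 * (1 + Real.log (Fintype.card (Σ s, A s) * B))
        * √(M.diameter * M.hittingTime π M.init * K) := by
  obtain ⟨πf, hπf, hTf⟩ := exists_fastPolicy hM M.init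
  have hB : 1 ≤ B := (one_le_fastTime hM _).trans hTB
  have hD := one_le_diameter hM
  have hK' : (1 : ℝ) ≤ K := by exact_mod_cast hK
  have hΛ : 1 ≤ 1 + Real.log (Fintype.card (Σ s, A s) * B) := by
    linarith [log_le_log_card_mul hM hB, Real.log_nonneg hB]
  have hfast : (cs.map fun c => M.costToGo c πf M.init).sum ≤ M.diameter * K := by
    refine (sum_costToGo_le hπf hcs).trans ?_
    rw [hlen, hTf, mul_comm]
    exact mul_le_mul_of_nonneg_right (fastTime_le_diameter _) (by linarith)
  have hbest := hπ.2 πf hπf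
  rcases hcov with hc | hc
  · refine (cumMetaLoss_sub_le hM hK hBX hπ.1 hc hcs (hbest.trans hfast)).trans ?_
    exact mul_le_mul_of_nonneg_right (by linarith) (Real.sqrt_nonneg _)
  -- When `T⋆ ≥ D K`, the comparator cost is merely bounded below by 0. The fast policy costs at
  -- most `X`, and the regret against it is at most `84 Λ X`. The sum is at most `85 Λ X`, and `X ≤
  -- √(D T⋆ K)`.
  · have h1 := cumMetaLoss_sub_le hM hK hBX hπf (hTf.trans_le hTB) hcs hfast
    have h0 := sum_costToGo_nonneg (M := M) hcs π
    rw [hTf] at h1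
    set X := M.diameter * K with hX
    have hX1 : 1 ≤ X := hB.trans hBX
    have hXs : X ≤ √(M.diameter * M.hittingTime π M.init * K) := by
      refine Real.le_sqrt_of_sq_le ?_
      rw [show M.diameter * M.hittingTime π M.init * K = X * M.hittingTime π M.init by
        rw [hX]; ring]
      nlinarith
    have hfs : √(M.diameter * M.fastTime M.init * K) ≤ X := by
      refine Real.sqrt_le_iff.2 ⟨by linarith, ?_⟩
      rw [show M.diameter * M.fastTime M.init * K = X * M.fastTime M.init by rw [hX]; ring, sq]
      exact mul_le_mul_of_nonneg_left (hTB.trans hBX) (by linarith)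
    set Λ := 1 + Real.log (Fintype.card (Σ s, A s) * B)
    have h2 := mul_le_mul_of_nonneg_left hfs (by linarith : 0 ≤ 84 * Λ)
    have h3 := mul_le_mul_of_nonneg_left hXs (by linarith : 0 ≤ 85 * Λ)
    nlinarith

end Histories

end SSP

end

/-! ### Averaging the pathwise bound over histories -/

theorem mainTheorem3 :
    ∃ C : ℝ, 0 < C ∧
      ∀ {S : Type*} {A : S → Type*} [Fintype S] [DecidableEq S] [∀ s, Fintype (A s)]
        (M : SSP S A), (∃ π, M.IsProper π) →
      ∀ K : ℕ, 1 ≤ K → ∀ (B : ℝ) (adv : SSP.Adversary A (M.gridSize B)),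
        (∀ h x, adv h x ∈ Set.Icc (0 : ℝ) 1) →
      -- `πstar h` is a best policy in hindsight for the costs realized along `h`
      ∀ πstar : {h : SSP.History A (M.gridSize B) // h.length = K} → (s : S) → A s,
        (∀ h, M.IsBestInHindsight (SSP.costs adv h.1) (πstar h)) →
        -- the grid reaches up to `D K`, or it reaches up to `K` and covers `T⋆`
        -- (apart from values of `T⋆` for which the bound exceeds `D K`)
        (B = M.diameter * K ∨
          (B = K ∧ M.fastTime M.init ≤ K ∧
            ∀ h, M.historyProb K adv h.1 ≠ 0 →
              M.hittingTime (πstar h) M.init ≤ K ∨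
                M.diameter * K ≤ M.hittingTime (πstar h) M.init)) →
        -- all `K` episodes end with probability one
        HasSum (fun h : {h : SSP.History A (M.gridSize B) // h.length = K} =>
          M.historyProb K adv h.1) 1 ∧
        Summable (fun h : {h : SSP.History A (M.gridSize B) // h.length = K} =>
          M.historyProb K adv h.1 * M.regret adv (πstar h) h.1) ∧
        ∑' h : {h : SSP.History A (M.gridSize B) // h.length = K},
            M.historyProb K adv h.1 * M.regret adv (πstar h) h.1
          ≤ C * (1 + Real.log (Fintype.card (Σ s, A s) * B)) *
            ∑' h : {h : SSP.History A (M.gridSize B) // h.length = K},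
              M.historyProb K adv h.1 *
                √(M.diameter * M.hittingTime (πstar h) M.init * K) := by
  refine ⟨85, by norm_num, ?_⟩
  intro S A _ _ _ M hM K hK B adv hadv πstar hπ hB
  have hD := SSP.one_le_diameter hM
  have hK' : (1 : ℝ) ≤ K := by exact_mod_cast hK
  have hfD := SSP.fastTime_le_diameter (M := M) M.init
  obtain ⟨hBX, hTB, hcov⟩ : B ≤ M.diameter * K ∧ M.fastTime M.init ≤ B ∧
      ∀ h, M.historyProb K adv h.1 ≠ 0 → M.hittingTime (πstar h) M.init ≤ B ∨
        M.diameter * K ≤ M.hittingTime (πstar h) M.init := by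
    rcases hB with hB | ⟨hB, hf, hcov⟩
    -- For `B = D K` the two alternatives for `T⋆` are exhaustive.
    · exact ⟨hB.le, by nlinarith, fun h _ => hB ▸ le_total _ _⟩
    · exact ⟨by nlinarith, hB ▸ hf, fun h hh => by rw [hB]; exact hcov h hh⟩
  -- Needed only to know that the grid is nonempty.
  obtain ⟨j, -, -⟩ := SSP.exists_grid hM le_rfl hTB
  have hp0 := fun h : {h : SSP.History A (M.gridSize B) // h.length = K} =>
    SSP.historyProb_nonneg hM hK j.pos (M := M) (K := K) (adv := adv) h.1
  obtain ⟨h1, a, b, hab, ha, hb⟩ :=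
    SSP.expectation_learnerCost_le hM hK j.pos hadv (M := M) (K := K) K
  have hunit := SSP.unitCosts_costs hadv
  obtain ⟨πf, hπf, hTf⟩ := SSP.exists_fastPolicy hM M.init
  have hg : Summable fun h : {h : SSP.History A (M.gridSize B) // h.length = K} =>
      M.historyProb K adv h.1 *
        ((SSP.costs adv h.1).map fun c => M.costToGo c (πstar h) M.init).sum := by
    refine SSP.summable_weight_mul h1.summable hp0
      (fun h => SSP.sum_costToGo_nonneg (hunit h.1) _)
      (b := K * M.hittingTime πf M.init) fun h => ((hπ h).2 πf hπf).trans ?_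
    have := SSP.sum_costToGo_le hπf (hunit h.1)
    rwa [SSP.length_costs, h.2] at this
  have hsqrt : Summable fun h : {h : SSP.History A (M.gridSize B) // h.length = K} =>
      M.historyProb K adv h.1 * √(M.diameter * M.hittingTime (πstar h) M.init * K) := by
    -- There are finitely many deterministic policies, so `T⋆` is bounded although it is random.
    obtain ⟨t, ht⟩ := Finite.bddAbove_range fun π : (s : S) → A s => M.hittingTime π M.init
    refine SSP.summable_weight_mul h1.summable hp0 (fun h => Real.sqrt_nonneg _)
      (b := √(M.diameter * t * K)) fun h => Real.sqrt_le_sqrt ?_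
    have := ht ⟨πstar h, rfl⟩
    gcongr
  have hreg := ha.sub hg.hasSum
  simp only [← mul_sub] at hreg
  change HasSum (fun h : {h : SSP.History A (M.gridSize B) // h.length = K} =>
      M.historyProb K adv h.1 * M.regret adv (πstar h) h.1) _ at hreg
  refine ⟨h1, hreg.summable, ?_⟩
  rw [hreg.tsum_eq, ← tsum_mul_left]
  refine (sub_le_sub_right hab _).trans ?_
  refine hasSum_le (fun h => ?_) (hb.sub hg.hasSum) (hsqrt.mul_left _).hasSum
  rw [← mul_sub]
  -- Coverage of `T⋆` is known only on histories of positive probability; the remaining terms are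
  -- zero.
  by_cases hh : M.historyProb K adv h.1 = 0
  · simp [hh]
  · have := mul_le_mul_of_nonneg_left (SSP.cumMetaLoss_sub_best_le hM hK hBX hTB
      ((SSP.length_costs adv h.1).trans h.2) (hunit h.1) (hπ h) (hcov h hh)) (hp0 h)
    linarith
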